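/- Let $I$ be a nonempty compact interval in the real line and let $f : I \to I$ be a continuous map; $f^n$ denotes the $n$-th iterate of $f$. For a compact interval $J \subset I$, a map $g : I \to I$ is called turbulent on $J$ if there are two nondegenerate compact subintervals $J_0, J_1$ of $J$ with at most one point in common such that $g(J_0) \cap g(J_1) \supset J_0 \cup J_1$. The map $g$ is called doubly turbulent (on $I$) if there are two nondegenerate compact subintervals $K, L$ of $I$ with at most one point in common such that $g$ is turbulent on $K$ and on $L$. Periods are least periods. A point $x \in I$ is chain recurrent if for every $\varepsilon > 0$ there are $n \ge 1$ and points $x_0 = x, x_1, \dots, x_n = x$ of $I$ with $|f(x_i) - x_{i+1}| < \varepsilon$ for $0 \le i \le n-1$. The $\omega$-limit set $\omega_f(b)$ of $b \in I$ is the set of limit points of the sequence $(f^n(b))_{n \ge 0}$. A point $x \in I$ is asymptotically periodic of period 1 or 2 if there is $y \in I$ with $f^2(y) = y$ and $\lim_{n\to\infty} |f^n(x) - f^n(y)| = 0$. The map $f$ is densely chaotic if the set of pairs $(x,y) \in I \times I$ with $\limsup_{n\to\infty} |f^n(x) - f^n(y)| > 0$ and $\liminf_{n\to\infty} |f^n(x)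 - f^n(y)| = 0$ is dense in $I \times I$. Then each of the following conditions implies that $f$ has periodic points of all even periods $2, 4, 6, \dots$ and that $f^2$ is doubly turbulent: (1) There are a point $c \in I$ and an odd integer $n > 1$ such that $f^n(c) \le c < f(c)$ or $f(c) < c \le f^n(c)$. In particular, the conclusion holds if $f$ has a periodic point of odd period $> 1$. (2) The chain recurrent points of $f$ are dense in $I$, and $f^2(a) \ne a$ for some point $a \in I$. (3) The $\omega$-limit set $\omega_f(b)$ of some point $b \in I$ contains a fixed point $z$ of $f$ and a point different from $z$. (4) There is a point in $I$ that is not asymptotically periodic of period 1 or 2, and the set $\{(x,y) \in I \times I : \liminf_{n\to\infty} |f^n(x) - f^n(y)| = 0\}$ is dense in $I \times I$. In particular, the conclusion holds if $f$ is densely chaotic. (5) There is a point $c \in I$ such that $\limsup_{n\to\infty} |f^n(c) - f^{n+1}(c)| > 0$ and $\liminf_{n\to\infty} |f^n(c) - f^{n+1}(c)| = 0$. -/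

import Mathlib

open Filter Topology Set

/-- `g` is turbulent on the subset `J` of a linearly ordered space (in the use below, `J` is a
compact interval): there are two nondegenerate compact intervals `[p, q]` and `[r, s]` in `J`, with
at most one point in common, such that the image of each of them contains both of them. -/
def IsTurbulentOn {X : Type*} [LinearOrder X] (g : X → X) (J : Set X) : Prop :=
  ∃ p q r s : X, p < q ∧ r < s ∧ Icc p q ⊆ J ∧ Icc r s ⊆ J ∧
    (Icc p q ∩ Icc r s).Subsingleton ∧
    Icc p q ∪ Icc r s ⊆ g '' Icc p q ∩ g '' Icc r s

/-- `g` is doubly turbulent: it is turbulent on each of two (nondegenerate) compact intervals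
`K = [k₁, k₂]` and `L = [l₁, l₂]` that have at most one point in common. -/
def IsDoublyTurbulent {X : Type*} [LinearOrder X] (g : X → X) : Prop :=
  ∃ k₁ k₂ l₁ l₂ : X, k₁ < k₂ ∧ l₁ < l₂ ∧ (Icc k₁ k₂ ∩ Icc l₁ l₂).Subsingleton ∧
    IsTurbulentOn g (Icc k₁ k₂) ∧ IsTurbulentOn g (Icc l₁ l₂)

/-- `g` has periodic points of all even (least) periods. -/
def HasAllEvenPeriods {X : Type*} (g : X → X) : Prop :=
  ∀ m : ℕ, 1 ≤ m → ∃ x : X, Function.minimalPeriod g x = 2 * m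

/-- `x` is a chain recurrent point of `g`: for every `ε > 0` there is an `ε`-chain with at least
one step from `x` to itself. -/
def IsChainRecurrentPt {X : Type*} [PseudoMetricSpace X] (g : X → X) (x : X) : Prop :=
  ∀ ε : ℝ, 0 < ε → ∃ (n : ℕ) (u : ℕ → X), 1 ≤ n ∧ u 0 = x ∧ u n = x ∧
    ∀ i < n, dist (g (u i)) (u (i + 1)) < ε

/-- The `ω`-limit set of the point `b` under iteration of `g`. -/
def omegaLimitSet {X : Type*} [TopologicalSpace X] (g : X → X) (b : X) : Set X :=
  omegaLimit atTop (fun (n : ℕ) (x : X) => g^[n] x) {b}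

/-- `x` is asymptotically periodic of period 1 or 2: its orbit is asymptotic to the orbit of a
point `y` with `g² y = y`. -/
def IsAsymptPeriodicOneOrTwo {X : Type*} [PseudoMetricSpace X] (g : X → X) (x : X) : Prop :=
  ∃ y : X, g (g y) = y ∧ Tendsto (fun n : ℕ => dist (g^[n] x) (g^[n] y)) atTop (𝓝 0)

/-- The pairs whose orbits come arbitrarily close to each other. -/
def proximalPairs {X : Type*} [PseudoMetricSpace X] (g : X → X) : Set (X × X) :=
  {w | liminf (fun n : ℕ => dist (g^[n] w.1) (g^[n] w.2)) atTop = 0}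

/-- The Li–Yorke pairs of `g`. -/
def liYorkePairs {X : Type*} [PseudoMetricSpace X] (g : X → X) : Set (X × X) :=
  {w | 0 < limsup (fun n : ℕ => dist (g^[n] w.1) (g^[n] w.2)) atTop ∧
    liminf (fun n : ℕ => dist (g^[n] w.1) (g^[n] w.2)) atTop = 0}

/-- `g` is densely chaotic: its Li–Yorke pairs are dense in the product. -/
def IsDenselyChaotic {X : Type*} [PseudoMetricSpace X] (g : X → X) : Prop :=
  Dense (liYorkePairs g)

/-!
All conditions produce the same object, a one-sided horseshoe: points `a < e < b` on one side of a
point `z`, all thrown over `z` by `f`, such that `f²` maps each of `[a, e]` and `[e, b]` over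
`[a, b]`. The covering relations of `f²` give points of every period `m` whose `f²`-orbit stays on
the side of `[a, b]` while `f` maps it to the other side, so their period under `f` is `2m`. The
image of the horseshoe on the other side of `z` is a second interval of turbulence of `f²`.

Suppose now that `f` has no one-sided horseshoe. Then no odd iterate can bring a point back to or
beyond its starting position against its first move. Consequently, in a non-convergent orbit all
points moving up lie to the left of all points moving down, a fixed point `z` divides the two
kinds, and the orbit eventually alternates around `z`. If such an orbit accumulates at `z`, it
converges to `z`; this excludes (3) and (5). If it is not asymptotically periodic, then `f²` moves
some point `y` of it away from `z`, all points between `f² y` and `y` alternate around `z` in the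
same phase as `y`, and no orbit starting strictly between `f² y` and `y` is proximal to one starting
between `f³ y` and `f y`; this excludes (4). Finally, dense chain recurrence forbids proper trapping
regions, and without them the absence of a horseshoe forces `f` to swap the two sides of a single
fixed point, and then `f²` to be the identity; this excludes (2).
-/

section Crossing

variable {X Y : Type*} [ConditionallyCompleteLinearOrder X] [DenselyOrdered X]
  [TopologicalSpace X] [OrderTopology X] [LinearOrder Y] [TopologicalSpace Y]
  [OrderClosedTopology Y] {f g : X → Y} {p q : X}

theorem exists_first_eq_of_le (hf : Continuous f) (hg : Continuous g) (hpq : p ≤ q)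
    (hp : f p ≤ g p) (hq : g q ≤ f q) :
    ∃ t ∈ Icc p q, f t = g t ∧ ∀ s ∈ Ico p t, f s < g s := by
  have hS : IsCompact (Icc p q ∩ {t | g t ≤ f t}) :=
    isCompact_Icc.inter_right (isClosed_le hg hf)
  obtain ⟨t, ⟨ht, hgf⟩, hleast⟩ := hS.exists_isLeast ⟨q, right_mem_Icc.2 hpq, hq⟩
  have hfg : f t ≤ g t := by
    obtain ⟨s, hs, hfs⟩ := isPreconnected_Icc.intermediate_value₂ (left_mem_Icc.2 ht.1)
      (right_mem_Icc.2 ht.1) hf.continuousOn hg.continuousOn hp hgf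
    rw [← le_antisymm hs.2 (hleast ⟨⟨hs.1, hs.2.trans ht.2⟩, hfs.ge⟩)]
    exact hfs.le
  refine ⟨t, ht, hfg.antisymm hgf, fun s hs => lt_of_not_ge fun h => ?_⟩
  exact hs.2.not_ge (hleast ⟨⟨hs.1, hs.2.le.trans ht.2⟩, h⟩)

theorem exists_last_eq_of_le (hf : Continuous f) (hg : Continuous g) (hpq : p ≤ q)
    (hp : f p ≤ g p) (hq : g q ≤ f q) :
    ∃ t ∈ Icc p q, f t = g t ∧ ∀ s ∈ Ioc t q, g s < f s := by
  obtain ⟨t, ht, heq, hlt⟩ := exists_first_eq_of_le (X := Xᵒᵈ) (p := q) (q := p) hg hf hpq hq hp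
  exact ⟨t, ht.symm, heq.symm, fun s hs => hlt s hs.symm⟩

theorem exists_Icc_subset_image_eq_Icc (hf : Continuous f) (hpq : p ≤ q) (h : f p ≤ f q) :
    ∃ c d, c ≤ d ∧ Icc c d ⊆ Icc p q ∧ f '' Icc c d = Icc (f p) (f q) := by
  obtain ⟨d, hd, hfd, hltd⟩ := exists_first_eq_of_le hf continuous_const hpq h le_rfl
  obtain ⟨c, hc, hfc, hltc⟩ :=
    exists_last_eq_of_le hf continuous_const hd.1 le_rfl (h.trans hfd.ge)
  refine ⟨c, d, hc.2, Icc_subset_Icc hc.1 hd.2, Subset.antisymm ?_ ?_⟩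
  · rintro _ ⟨s, hs, rfl⟩
    constructor
    · rcases hs.1.eq_or_lt with rfl | hlt
      exacts [hfc.ge, (hltc s ⟨hlt, hs.2⟩).le]
    · rcases hs.2.eq_or_lt with rfl | hlt
      exacts [hfd.le, (hltd s ⟨hc.1.trans hs.1, hlt⟩).le]
  · simpa only [hfc, hfd] using intermediate_value_Icc hc.2 hf.continuousOn

theorem exists_Icc_subset_uIcc_image_eq (hf : Continuous f) (p q : X) :
    ∃ c d, c ≤ d ∧ Icc c d ⊆ uIcc p q ∧ f '' Icc c d = uIcc (f p) (f q) := by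
  wlog hpq : p ≤ q generalizing p q
  · simpa only [uIcc_comm] using this q p (le_of_not_ge hpq)
  rcases le_total (f p) (f q) with h | h
  · simpa only [uIcc_of_le hpq, uIcc_of_le h] using exists_Icc_subset_image_eq_Icc hf hpq h
  · obtain ⟨c, d, hcd, hsub, himage⟩ :=
      exists_Icc_subset_image_eq_Icc (Y := Yᵒᵈ) hf hpq h
    refine ⟨c, d, hcd, by rwa [uIcc_of_le hpq], ?_⟩
    exact himage.trans (by rw [uIcc_of_ge h]; exact Set.ext fun _ => and_comm)

end Crossing

section Itinerary

variable {X : Type*} [ConditionallyCompleteLinearOrder X] [DenselyOrdered X]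
  [TopologicalSpace X] [OrderTopology X] {g : X → X}

theorem exists_Icc_subset_image_eq (hg : Continuous g) {a b l r : X} (hlr : l ≤ r)
    (hsub : Icc l r ⊆ g '' Icc a b) :
    ∃ c d, c ≤ d ∧ Icc c d ⊆ Icc a b ∧ g '' Icc c d = Icc l r := by
  obtain ⟨p, hp, rfl⟩ := hsub (left_mem_Icc.2 hlr)
  obtain ⟨q, hq, rfl⟩ := hsub (right_mem_Icc.2 hlr)
  obtain ⟨c, d, hcd, hcd', himage⟩ := exists_Icc_subset_uIcc_image_eq hg p q
  exact ⟨c, d, hcd, hcd'.trans (uIcc_subset_Icc hp hq), himage.trans (uIcc_of_le hlr)⟩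

theorem exists_Icc_itinerary (hg : Continuous g) (n : ℕ) (l r : ℕ → X) (hlr : ∀ i, l i ≤ r i)
    (hcover : ∀ i < n, Icc (l (i + 1)) (r (i + 1)) ⊆ g '' Icc (l i) (r i)) :
    ∃ c d, c ≤ d ∧ g^[n] '' Icc c d = Icc (l n) (r n) ∧
      ∀ x ∈ Icc c d, ∀ i ≤ n, g^[i] x ∈ Icc (l i) (r i) := by
  induction n generalizing l r with
  | zero => exact ⟨l 0, r 0, hlr 0, image_id _, fun x hx i hi => by simpa [Nat.le_zero.1 hi]⟩
  | succ n ih =>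
    obtain ⟨c', d', hcd', himage', hmem'⟩ := ih (fun i => l (i + 1)) (fun i => r (i + 1))
      (fun i => hlr _) fun i hi => hcover _ (by lia)
    have hsub' : Icc c' d' ⊆ Icc (l 1) (r 1) := fun x hx => hmem' x hx 0 n.zero_le
    obtain ⟨c, d, hcd, hsub, himage⟩ :=
      exists_Icc_subset_image_eq hg hcd' (hsub'.trans (hcover 0 n.succ_pos))
    refine ⟨c, d, hcd, by rw [Function.iterate_succ, image_comp, himage, himage'], ?_⟩
    rintro x hx (_ | i) hi
    · exact hsub hx
    · exact hmem' (g x) (himage ▸ mem_image_of_mem g hx) i (by lia)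

theorem exists_isPeriodicPt_of_covering_loop (hg : Continuous g) (n : ℕ) (l r : ℕ → X)
    (hlr : ∀ i, l i ≤ r i)
    (hcover : ∀ i < n, Icc (l (i + 1)) (r (i + 1)) ⊆ g '' Icc (l i) (r i))
    (hl : l n = l 0) (hr : r n = r 0) :
    ∃ x, Function.IsPeriodicPt g n x ∧ ∀ i ≤ n, g^[i] x ∈ Icc (l i) (r i) := by
  obtain ⟨c, d, hcd, himage, hmem⟩ := exists_Icc_itinerary hg n l r hlr hcover
  have hsurj : SurjOn g^[n] (Icc c d) (Icc c d) := by
    rw [SurjOn, himage, hl, hr]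
    exact fun x hx => hmem x hx 0 n.zero_le
  obtain ⟨x, hx, hfix⟩ := exists_mem_Icc_isFixedPt_of_surjOn (hg.iterate n).continuousOn hcd hsurj
  exact ⟨x, hfix, hmem x hx⟩

end Itinerary

section EvenPeriods

theorem minimalPeriod_eq_two_mul {X : Type*} {f : X → X} {x : X}
    (h : ∀ i, f ((f^[2])^[i] x) ≠ x) :
    Function.minimalPeriod f x = 2 * Function.minimalPeriod f^[2] x := by
  rw [Function.minimalPeriod_iterate_eq_div_gcd two_ne_zero]
  rcases Nat.even_or_odd' (Function.minimalPeriod f x) with ⟨k, hk | hk⟩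
  · rw [hk, Nat.gcd_mul_right_left, Nat.mul_div_cancel_left k two_pos]
  · have hper := Function.iterate_minimalPeriod (f := f) (x := x)
    rw [hk, Function.iterate_succ_apply', Function.iterate_mul] at hper
    exact absurd hper (h k)

variable {X : Type*} [ConditionallyCompleteLinearOrder X] [DenselyOrdered X]
  [TopologicalSpace X] [OrderTopology X]

theorem exists_minimalPeriod_eq_of_horseshoe {g : X → X} (hg : Continuous g) {l₀ r₀ e l₁ r₁ : X}
    (h₀ : l₀ ≤ r₀) (h₁ : l₁ ≤ r₁) (hr₀ : r₀ ≤ e) (hl₁ : e ≤ l₁) (he : g e < e)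
    (hcover₀ : Icc l₀ r₀ ∪ Icc l₁ r₁ ⊆ g '' Icc l₀ r₀)
    (hcover₁ : Icc l₀ r₀ ∪ Icc l₁ r₁ ⊆ g '' Icc l₁ r₁) {m : ℕ} (hm : 1 ≤ m) :
    ∃ x ≤ e, Function.minimalPeriod g x = m ∧ ∀ i, g^[i] x ∈ Icc l₀ r₀ ∪ Icc l₁ r₁ := by
  set l : ℕ → X := fun i => if i % m = 0 then l₀ else l₁ with hl
  set r : ℕ → X := fun i => if i % m = 0 then r₀ else r₁ with hr
  have hlr : ∀ i, l i ≤ r i := fun i => by simp only [hl, hr]; split_ifs <;> assumption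
  have hunion : ∀ i, Icc (l i) (r i) ⊆ Icc l₀ r₀ ∪ Icc l₁ r₁ := fun i => by
    simp only [hl, hr]; split_ifs <;> simp
  have hcover : ∀ i, Icc l₀ r₀ ∪ Icc l₁ r₁ ⊆ g '' Icc (l i) (r i) := fun i => by
    simp only [hl, hr]; split_ifs <;> assumption
  obtain ⟨x, hper, hmem⟩ := exists_isPeriodicPt_of_covering_loop hg m l r hlr
    (fun i _ => (hunion (i + 1)).trans (hcover i)) (by simp [hl]) (by simp [hr])
  have hxe : x ≤ e := by
    have := (hmem 0 m.zero_le).2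
    simp only [hr, Nat.zero_mod, if_true] at this
    exact this.trans hr₀
  have hright : ∀ i, 0 < i → i < m → e ≤ g^[i] x := fun i hi him => by
    have := (hmem i him.le).1
    simp only [hl, Nat.mod_eq_of_lt him, hi.ne', if_false] at this
    exact hl₁.trans this
  refine ⟨x, hxe, (hper.minimalPeriod_le hm).antisymm (le_of_not_gt fun hlt => ?_), fun i => ?_⟩
  · have hret := hright _ (hper.minimalPeriod_pos hm) hlt
    rw [Function.iterate_minimalPeriod] at hret
    have hpos := hper.minimalPeriod_pos hm
    obtain rfl : x = e := hxe.antisymm hret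
    exact he.not_ge (hright 1 one_pos (by lia))
  · rw [← hper.iterate_mod_apply]
    exact hunion _ (hmem _ (Nat.mod_lt i hm).le)

/-- The second iterate of `f` has a horseshoe on `[a, e] ∪ [e, b]` of valley shape, and `f` throws
its three corners over the point `z ≥ b`, which makes the periods under `f` twice those under
`f^[2]`. -/
def HasLeftHorseshoe {X : Type*} [Preorder X] (f : X → X) : Prop :=
  ∃ a e b z, a < e ∧ e < b ∧ b ≤ z ∧ z ≤ f a ∧ z ≤ f e ∧ z ≤ f b ∧
    b ≤ f (f a) ∧ b ≤ f (f b) ∧ f (f e) ≤ a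

theorem exists_Icc_subset_uIcc_sq_image {f : X → X} (hf : Continuous f) (p q : X) :
    ∃ c d, c ≤ d ∧ Icc c d ⊆ uIcc p q ∧ MapsTo f (Icc c d) (uIcc (f p) (f q)) ∧
      uIcc (f (f p)) (f (f q)) ⊆ f^[2] '' Icc c d := by
  obtain ⟨c, d, hcd, hsub, himage⟩ := exists_Icc_subset_uIcc_image_eq hf p q
  refine ⟨c, d, hcd, hsub, mapsTo_iff_image_subset.2 himage.subset, ?_⟩
  rw [Function.iterate_succ, Function.iterate_one, image_comp, himage]
  exact intermediate_value_uIcc hf.continuousOn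

theorem HasLeftHorseshoe.hasAllEvenPeriods {f : X → X} (hf : Continuous f)
    (h : HasLeftHorseshoe f) : HasAllEvenPeriods f := by
  obtain ⟨a, e, b, z, hae, heb, hbz, hza, hze, hzb, hffa, hffb, hffe⟩ := h
  obtain ⟨l₀, r₀, hlr₀, hsub₀, hmaps₀, hcover₀⟩ := exists_Icc_subset_uIcc_sq_image hf a e
  obtain ⟨l₁, r₁, hlr₁, hsub₁, hmaps₁, hcover₁⟩ := exists_Icc_subset_uIcc_sq_image hf e b
  have hab : Icc l₀ r₀ ∪ Icc l₁ r₁ ⊆ Icc a b := by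
    rw [uIcc_of_le hae.le] at hsub₀
    rw [uIcc_of_le heb.le] at hsub₁
    exact union_subset (hsub₀.trans (Icc_subset_Icc_right heb.le))
      (hsub₁.trans (Icc_subset_Icc_left hae.le))
  have habove : ∀ t ∈ Icc l₀ r₀ ∪ Icc l₁ r₁, z ≤ f t := by
    rintro t (ht | ht)
    exacts [(le_min hza hze).trans (hmaps₀ ht).1, (le_min hze hzb).trans (hmaps₁ ht).1]
  rw [uIcc_of_ge (hffe.trans (hae.trans heb |>.le.trans hffa))] at hcover₀
  rw [uIcc_of_le (hffe.trans (hae.trans heb |>.le.trans hffb))] at hcover₁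
  intro m hm
  obtain ⟨x, hxe, hx, horbit⟩ := exists_minimalPeriod_eq_of_horseshoe (hf.iterate 2) hlr₀ hlr₁
    (e := e) ((uIcc_of_le hae.le ▸ hsub₀) (right_mem_Icc.2 hlr₀)).2
    ((uIcc_of_le heb.le ▸ hsub₁) (left_mem_Icc.2 hlr₁)).1 (hffe.trans_lt hae)
    (hab.trans ((Icc_subset_Icc hffe hffa).trans hcover₀))
    (hab.trans ((Icc_subset_Icc hffe hffb).trans hcover₁)) hm
  refine ⟨x, hx ▸ minimalPeriod_eq_two_mul fun i => ne_of_gt ?_⟩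
  exact (hxe.trans_lt (heb.trans_le hbz)).trans_le (habove _ (horbit i))

end EvenPeriods

section DoubleTurbulence

variable {X Y : Type*} [ConditionallyCompleteLinearOrder X] [DenselyOrdered X]
  [TopologicalSpace X] [OrderTopology X]

theorem isTurbulentOn_Icc_of_subset_uIcc {g : X → X} (hg : Continuous g) {a e b : X} (hae : a < e)
    (heb : e < b) (hleft : Icc a b ⊆ uIcc (g a) (g e)) (hright : Icc a b ⊆ uIcc (g e) (g b)) :
    IsTurbulentOn g (Icc a b) := by
  refine ⟨a, e, e, b, hae, heb, Icc_subset_Icc_right heb.le, Icc_subset_Icc_left hae.le, ?_, ?_⟩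
  · rintro x ⟨hx, hx'⟩ y ⟨hy, hy'⟩
    exact (hx.2.antisymm hx'.1).trans (hy.2.antisymm hy'.1).symm
  · rw [Icc_union_Icc_eq_Icc hae.le heb.le]
    refine subset_inter (hleft.trans ?_) (hright.trans ?_)
    · simpa only [uIcc_of_le hae.le] using
        intermediate_value_uIcc (a := a) (b := e) hg.continuousOn
    · simpa only [uIcc_of_le heb.le] using
        intermediate_value_uIcc (a := e) (b := b) hg.continuousOn

theorem isTurbulentOn_Icc_of_valley {g : X → X} (hg : Continuous g) {a e b : X} (hae : a < e)
    (heb : e < b) (ha : b ≤ g a) (he : g e ≤ a) (hb : b ≤ g b) : IsTurbulentOn g (Icc a b) :=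
  have hab : a ≤ b := (hae.trans heb).le
  isTurbulentOn_Icc_of_subset_uIcc hg hae heb
    (uIcc_of_ge (he.trans (hab.trans ha)) ▸ Icc_subset_Icc he ha)
    (uIcc_of_le (he.trans (hab.trans hb)) ▸ Icc_subset_Icc he hb)

theorem isTurbulentOn_Icc_of_peak {g : X → X} (hg : Continuous g) {a e b : X} (hae : a < e)
    (heb : e < b) (ha : g a ≤ a) (he : b ≤ g e) (hb : g b ≤ a) : IsTurbulentOn g (Icc a b) :=
  have hab : a ≤ b := (hae.trans heb).le
  isTurbulentOn_Icc_of_subset_uIcc hg hae heb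
    (uIcc_of_le (ha.trans (hab.trans he)) ▸ Icc_subset_Icc ha he)
    (uIcc_of_ge (hb.trans (hab.trans he)) ▸ Icc_subset_Icc hb he)

variable [LinearOrder Y] [TopologicalSpace Y] [OrderClosedTopology Y]

theorem exists_lt_lt_eq_eq_eq {f : X → Y} (hf : Continuous f) {u w : X} {a e b : Y} (huw : u ≤ w)
    (hae : a < e) (heb : e < b) (hu : f u ≤ a) (hw : b ≤ f w) :
    ∃ y₁ y₂ y₃, u ≤ y₁ ∧ y₁ < y₂ ∧ y₂ < y₃ ∧ y₃ ≤ w ∧ f y₁ = a ∧ f y₂ = e ∧ f y₃ = b := by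
  obtain ⟨y₁, hy₁, rfl⟩ :=
    intermediate_value_Icc huw hf.continuousOn ⟨hu, (hae.trans heb).le.trans hw⟩
  obtain ⟨y₂, hy₂, rfl⟩ :=
    intermediate_value_Icc hy₁.2 hf.continuousOn ⟨hae.le, heb.le.trans hw⟩
  obtain ⟨y₃, hy₃, rfl⟩ := intermediate_value_Icc hy₂.2 hf.continuousOn ⟨heb.le, hw⟩
  exact ⟨y₁, y₂, y₃, hy₁.1, hy₂.1.lt_of_ne (ne_of_apply_ne f hae.ne),
    hy₃.1.lt_of_ne (ne_of_apply_ne f heb.ne), hy₃.2, rfl, rfl, rfl⟩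

theorem exists_lt_lt_eq_eq_eq_of_valley {f : X → Y} (hf : Continuous f) {u v w : X} {a b : Y}
    (huv : u ≤ v) (hvw : v ≤ w) (hab : a < b) (hu : b ≤ f u) (hv : f v ≤ a) (hw : b ≤ f w) :
    ∃ y₁ y₂ y₃, u ≤ y₁ ∧ y₁ < y₂ ∧ y₂ < y₃ ∧ y₃ ≤ w ∧ f y₁ = b ∧ f y₂ = a ∧ f y₃ = b := by
  obtain ⟨y₁, hy₁, rfl⟩ :=
    intermediate_value_Icc' huv hf.continuousOn ⟨hv.trans hab.le, hu⟩
  obtain ⟨y₂, hy₂, rfl⟩ := intermediate_value_Icc' hy₁.2 hf.continuousOn ⟨hv, hab.le⟩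
  obtain ⟨y₃, hy₃, hy₃'⟩ :=
    intermediate_value_Icc (hy₂.2.trans hvw) hf.continuousOn ⟨hab.le, hw⟩
  exact ⟨y₁, y₂, y₃, hy₁.1, hy₂.1.lt_of_ne (ne_of_apply_ne f hab.ne'),
    hy₃.1.lt_of_ne (ne_of_apply_ne f (hy₃' ▸ hab.ne)), hy₃.2, rfl, rfl, hy₃'⟩

theorem exists_isTurbulentOn_right_of_leftHorseshoe {f : X → X} (hf : Continuous f)
    {a e b z : X} (hae : a < e) (heb : e < b) (hza : z ≤ f a) (hze : z ≤ f e) (hzb : z ≤ f b)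
    (hffa : b ≤ f (f a)) (hffb : b ≤ f (f b)) (hffe : f (f e) ≤ a) :
    ∃ y₁ y₂, z ≤ y₁ ∧ y₁ < y₂ ∧ IsTurbulentOn f^[2] (Icc y₁ y₂) := by
  have hab : a < b := hae.trans heb
  rcases lt_or_ge (f e) (f a) with hA | hA <;> rcases lt_or_ge (f e) (f b) with hB | hB
  · obtain ⟨y₁, y₂, y₃, hy₁, h₁₂, h₂₃, hy₃, rfl, rfl, rfl⟩ := exists_lt_lt_eq_eq_eq hf
      (le_min hA.le hB.le) hae heb hffe (min_rec' (b ≤ f ·) hffa hffb)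
    exact ⟨y₁, y₃, hze.trans hy₁, h₁₂.trans h₂₃, isTurbulentOn_Icc_of_valley (hf.iterate 2)
      h₁₂ h₂₃ (hy₃.trans (min_le_left _ _)) hy₁ (hy₃.trans (min_le_right _ _))⟩
  · obtain ⟨y₁, y₂, y₃, hy₁, h₁₂, h₂₃, hy₃, rfl, rfl, hy₃'⟩ :=
      exists_lt_lt_eq_eq_eq_of_valley hf hB hA.le hab hffb hffe hffa
    refine ⟨y₁, y₃, hzb.trans hy₁, h₁₂.trans h₂₃,
      isTurbulentOn_Icc_of_peak (hf.iterate 2) h₁₂ h₂₃ hy₁ hy₃ ?_⟩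
    exact (congrArg f hy₃').trans_le hy₁
  · obtain ⟨y₁, y₂, y₃, hy₁, h₁₂, h₂₃, hy₃, rfl, rfl, hy₃'⟩ :=
      exists_lt_lt_eq_eq_eq_of_valley hf hA hB.le hab hffa hffe hffb
    refine ⟨y₁, y₃, hza.trans hy₁, h₁₂.trans h₂₃, isTurbulentOn_Icc_of_valley (hf.iterate 2)
      h₁₂ h₂₃ ?_ hy₁ (hy₃.trans_eq (congrArg f hy₃').symm)⟩
    exact hy₃
  · obtain ⟨y₁, y₂, y₃, hy₁, h₁₂, h₂₃, hy₃, rfl, rfl, rfl⟩ := exists_lt_lt_eq_eq_eq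
      (Y := Xᵒᵈ) hf (max_le hA hB) heb hae (max_rec' (b ≤ f ·) hffa hffb) hffe
    exact ⟨y₁, y₃, (hza.trans (le_max_left _ _)).trans hy₁, h₁₂.trans h₂₃,
      isTurbulentOn_Icc_of_peak (hf.iterate 2) h₁₂ h₂₃ ((le_max_right _ _).trans hy₁) hy₃
        ((le_max_left _ _).trans hy₁)⟩

theorem HasLeftHorseshoe.isDoublyTurbulent {f : X → X} (hf : Continuous f)
    (h : HasLeftHorseshoe f) : IsDoublyTurbulent f^[2] := by
  obtain ⟨a, e, b, z, hae, heb, hbz, hza, hze, hzb, hffa, hffb, hffe⟩ := h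
  obtain ⟨y₁, y₂, hzy, hy, hturb⟩ := exists_isTurbulentOn_right_of_leftHorseshoe hf hae heb
    hza hze hzb hffa hffb hffe
  refine ⟨a, b, y₁, y₂, hae.trans heb, hy, ?_,
    isTurbulentOn_Icc_of_valley (hf.iterate 2) hae heb hffa hffe hffb, hturb⟩
  rintro x ⟨hx, hx'⟩ y ⟨hy, hy'⟩
  have hby : b ≤ y₁ := hbz.trans hzy
  exact (hx.2.antisymm (hby.trans hx'.1)).trans (hy.2.antisymm (hby.trans hy'.1)).symm

end DoubleTurbulence

section OrderReversal

variable {X : Type*} [LinearOrder X] {g : X → X}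

theorem IsTurbulentOn.of_orderDual {J : Set X} (h : IsTurbulentOn (X := Xᵒᵈ) g J) :
    IsTurbulentOn g J := by
  obtain ⟨p, q, r, s, hpq, hrs, hJ, hJ', hsub, hcover⟩ := h
  have dual_Icc : ∀ x y : X, Icc (α := Xᵒᵈ) x y = Icc (α := X) y x :=
    fun x y => Set.ext fun _ => and_comm
  rw [dual_Icc p q, dual_Icc r s] at *
  exact ⟨q, p, s, r, hpq, hrs, hJ, hJ', hsub, hcover⟩

theorem IsDoublyTurbulent.of_orderDual (h : IsDoublyTurbulent (X := Xᵒᵈ) g) :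
    IsDoublyTurbulent g := by
  obtain ⟨k₁, k₂, l₁, l₂, hk, hl, hsub, hturb, hturb'⟩ := h
  have dual_Icc : ∀ x y : X, Icc (α := Xᵒᵈ) x y = Icc (α := X) y x :=
    fun x y => Set.ext fun _ => and_comm
  rw [dual_Icc k₁ k₂, dual_Icc l₁ l₂] at *
  exact ⟨k₂, k₁, l₂, l₁, hk, hl, hsub, hturb.of_orderDual, hturb'.of_orderDual⟩

/-- `f` has a left horseshoe for one of the two orders of the line. This is what each of
the conditions produces and what the conclusion is drawn from. -/
def HasOneSidedHorseshoe {X : Type*} [Preorder X] (f : X → X) : Prop :=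
  HasLeftHorseshoe f ∨ HasLeftHorseshoe (X := Xᵒᵈ) f

theorem HasOneSidedHorseshoe.of_orderDual {X : Type*} [Preorder X] {f : X → X}
    (h : HasOneSidedHorseshoe (X := Xᵒᵈ) f) : HasOneSidedHorseshoe f :=
  h.symm

theorem HasOneSidedHorseshoe.hasAllEvenPeriods_and_isDoublyTurbulent {X : Type*}
    [ConditionallyCompleteLinearOrder X] [DenselyOrdered X] [TopologicalSpace X] [OrderTopology X]
    {f : X → X} (hf : Continuous f) (h : HasOneSidedHorseshoe f) :
    HasAllEvenPeriods f ∧ IsDoublyTurbulent f^[2] := by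
  rcases h with h | h
  · exact ⟨h.hasAllEvenPeriods hf, h.isDoublyTurbulent hf⟩
  · exact ⟨HasLeftHorseshoe.hasAllEvenPeriods (X := Xᵒᵈ) hf h,
      IsDoublyTurbulent.of_orderDual (by exact HasLeftHorseshoe.isDoublyTurbulent (X := Xᵒᵈ) hf h)⟩

end OrderReversal

section OddReturn

section Jump

variable {X : Type*} [ConditionallyCompleteLinearOrder X] [DenselyOrdered X]
  [TopologicalSpace X] [OrderTopology X] {f : X → X} {z : X}

theorem hasLeftHorseshoe_of_jump (hf : Continuous f) (hz : f z = z) {v w y : X} (hvw : v < w)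
    (hwz : w < z) (hv : f v ≤ z) (hzy : z < y) (hyw : y ≤ f w) (hy : f y ≤ v) :
    HasLeftHorseshoe f := by
  obtain ⟨u, hu, rfl⟩ := intermediate_value_Icc' hwz.le hf.continuousOn ⟨hz.trans_le hzy.le, hyw⟩
  have huz : u < z := hu.2.lt_of_ne fun h => hzy.ne (by rw [h, hz])
  obtain ⟨t, ht, htz⟩ := intermediate_value_Icc (hvw.le.trans hu.1) hf.continuousOn ⟨hv, hzy.le⟩
  have htu : t < u := ht.2.lt_of_ne fun h => hzy.ne' (h ▸ htz)
  exact ⟨t, u, z, z, htu, huz, le_rfl, htz.ge, hzy.le, hz.ge, by rw [htz, hz], by rw [hz, hz],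
    hy.trans ht.1⟩

/-- Call a point of `O` that `f` leaves on its side of the fixed point `z` a barrier. The point `y`
lies between `z` and all barriers on the left of `z`, and each barrier on the right of `z` is
separated from `z` by a point whose image is at most `y`. In the absence of horseshoes `f` carries
this condition to its mirror image, which forces an orbit in `O` to keep alternating around `z`. -/
def IsInnerLeft {X : Type*} [Preorder X] (f : X → X) (z : X) (O : Set X) (y : X) : Prop :=
  y < z ∧ (∀ v ∈ O, v < z → f v < z → v < y) ∧
    ∀ w ∈ O, z < w → z < f w → ∃ u, z < u ∧ u < w ∧ f u ≤ y

/-- The mirror image of `IsInnerLeft`, for a point `y` on the right of `z`; the images of inner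
left points are of this kind. -/
def IsInnerRight {X : Type*} [Preorder X] (f : X → X) (z : X) (O : Set X) (y : X) : Prop :=
  IsInnerLeft (X := Xᵒᵈ) f z O y

theorem IsInnerLeft.isInnerRight_map (hf : Continuous f) (hz : f z = z) {O : Set X} {y : X}
    (hno : ¬ HasLeftHorseshoe (X := Xᵒᵈ) f) (hy : IsInnerLeft f z O y) (hyO : y ∈ O)
    (hfy : f y ≠ z) : IsInnerRight f z O (f y) := by
  have hzfy : z < f y := hfy.symm.lt_of_le (le_of_not_gt fun h => lt_irrefl y (hy.2.1 y hyO hy.1 h))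
  refine ⟨hzfy, fun w hw hzw hfw => lt_of_not_ge fun hwy => ?_,
    fun v hv hvz hfv => ⟨y, hy.1, hy.2.1 v hv hvz hfv, le_rfl⟩⟩
  obtain ⟨u, hzu, huw, hfu⟩ := hy.2.2 w hw hzw hfw
  exact hno (hasLeftHorseshoe_of_jump (X := Xᵒᵈ) hf hz huw hzu hfw.le hy.1 hfu hwy)

theorem IsInnerRight.isInnerLeft_map (hf : Continuous f) (hz : f z = z) {O : Set X} {y : X}
    (hno : ¬ HasLeftHorseshoe f) (hy : IsInnerRight f z O y) (hyO : y ∈ O) (hfy : f y ≠ z) :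
    IsInnerLeft f z O (f y) :=
  IsInnerLeft.isInnerRight_map (X := Xᵒᵈ) hf hz hno hy hyO hfy

end Jump

/-- In the orbit segment `c, f c, …, f^[n] c`, the point `f^[m] c` is the highest one that moves up
and `z` is the fixed point that separates it from its image: no point of the segment lies between
`f^[m] c` and `z`, and all points beyond `z` move down. The alternation of an orbit that returns to
or below `c` is measured around this `z`. -/
structure IsReturnCenter {X : Type*} [Preorder X] (f : X → X) (c : X) (n m : ℕ) (z : X) : Prop where
  map_eq : f z = z
  lt_length : m < n
  lt_center : f^[m] c < z
  center_lt : z < f^[m + 1] c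
  ne_center : ∀ i ≤ n, f^[i] c ≠ z
  le_of_lt : ∀ i ≤ n, f^[i] c < z → f^[i] c ≤ f^[m] c
  map_lt : ∀ i < n, z < f^[i] c → f^[i + 1] c < f^[i] c

theorem iterate_eq_of_isFixedPt_iterate {X : Type*} {f : X → X} {c : X} {i n : ℕ} (hin : i ≤ n)
    (hfix : Function.IsFixedPt f (f^[i] c)) : f^[n] c = f^[i] c := by
  rw [← Nat.sub_add_cancel hin, Function.iterate_add_apply, hfix.iterate]

theorem exists_isReturnCenter {X : Type*} [CompleteLinearOrder X] [DenselyOrdered X]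
    [TopologicalSpace X] [OrderTopology X] {f : X → X} (hf : Continuous f) {c : X} {n : ℕ}
    (hn : 0 < n) (hle : f^[n] c ≤ c) (hlt : c < f c) :
    ∃ m z, c ≤ f^[m] c ∧ IsReturnCenter f c n m z := by
  obtain ⟨m, hm, hmax⟩ := ((Finset.range n).filter fun i => f^[i] c < f^[i + 1] c).exists_max_image
    (fun i => f^[i] c) ⟨0, Finset.mem_filter.2 ⟨Finset.mem_range.2 hn, hlt⟩⟩
  simp only [Finset.mem_filter, Finset.mem_range, and_imp, Function.iterate_succ_apply']
    at hm hmax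
  have hcm : c ≤ f^[m] c := hmax 0 hn hlt
  obtain ⟨z, hz, hfz, hup⟩ :=
    exists_first_eq_of_le continuous_id hf le_top hm.2.le (le_top (a := f ⊤))
  have hmz : f^[m] c < z := hz.1.lt_of_ne fun h => hm.2.ne (h ▸ hfz)
  have hnofix : ∀ i ≤ n, f^[m] c < f^[i] c → ¬ Function.IsFixedPt f (f^[i] c) :=
    fun i hi hlt hfix =>
      (hle.trans hcm).not_gt (iterate_eq_of_isFixedPt_iterate hi hfix ▸ hlt)
  have hne : ∀ i ≤ n, f^[i] c ≠ z := fun i hi h =>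
    hnofix i hi (h ▸ hmz) (h ▸ hfz.symm)
  have hleft : ∀ i ≤ n, f^[i] c < z → f^[i] c ≤ f^[m] c := by
    refine fun i hi hiz => le_of_not_gt fun hmi => ?_
    have hin : i ≠ n := fun h => (hle.trans hcm).not_gt (h ▸ hmi)
    exact hmi.not_ge (hmax i (hi.lt_of_ne hin) (hup _ ⟨hmi.le, hiz⟩))
  refine ⟨m, z, hcm, hfz.symm, hm.1, hmz, ?_, hne, hleft, fun i hi hzi => ?_⟩
  · rw [Function.iterate_succ_apply']
    refine lt_of_not_ge fun hle => hm.2.not_ge ?_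
    have := hleft (m + 1) hm.1 (lt_of_le_of_ne (by rwa [Function.iterate_succ_apply'])
      (hne _ hm.1))
    rwa [Function.iterate_succ_apply'] at this
  · rw [Function.iterate_succ_apply']
    refine lt_of_not_ge fun hge => ?_
    rcases hge.eq_or_lt with heq | hlt
    · exact hnofix i hi.le (hmz.trans hzi) heq.symm
    · exact (hmax i hi hlt).not_gt (hmz.trans hzi)

theorem IsReturnCenter.exists_crossing {X : Type*} [LinearOrder X] {f : X → X} {c z : X} {n m : ℕ}
    (h : IsReturnCenter f c n m z) (hn : f^[n] c < z) {i : ℕ}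
    (hi : i ≤ n) (hzi : z < f^[i] c) :
    ∃ j < n, z < f^[j] c ∧ f^[j] c ≤ f^[i] c ∧ f^[j + 1] c < z := by
  induction hi using Nat.decreasingInduction with
  | self => exact absurd hzi hn.not_gt
  | of_succ i hi ih =>
    rcases lt_or_gt_of_ne (h.ne_center (i + 1) hi) with hlt | hgt
    · exact ⟨i, hi, hzi, le_rfl, hlt⟩
    · obtain ⟨j, hj, hzj, hji, hjz⟩ := ih hgt
      exact ⟨j, hj, hzj, hji.trans (h.map_lt i hi hzi).le, hjz⟩

theorem IsReturnCenter.isInnerLeft_center {X : Type*} [LinearOrder X] {f : X → X} {c z : X}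
    {n m : ℕ} (h : IsReturnCenter f c n m z) (hn : f^[n] c < z) :
    IsInnerLeft f z {x | ∃ i < n, f^[i] c = x} (f^[m] c) := by
  refine ⟨h.lt_center, ?_, ?_⟩
  · rintro _ ⟨i, hi, rfl⟩ hvz hfv
    refine (h.le_of_lt i hi.le hvz).lt_of_ne fun heq => hfv.not_gt ?_
    rw [heq, ← Function.iterate_succ_apply' f]
    exact h.center_lt
  · rintro _ ⟨i, hi, rfl⟩ hzw hfw
    obtain ⟨j, hj, hzj, hji, hjz⟩ := h.exists_crossing hn hi.le hzw
    have hfj := h.le_of_lt (j + 1) hj hjz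
    rw [Function.iterate_succ_apply'] at hjz hfj
    exact ⟨f^[j] c, hzj, hji.lt_of_ne fun heq => hfw.not_gt (heq ▸ hjz), hfj⟩

theorem IsReturnCenter.isInner_iterate_add {X : Type*} [ConditionallyCompleteLinearOrder X]
    [DenselyOrdered X] [TopologicalSpace X] [OrderTopology X] {f : X → X} {c z : X} {n m : ℕ}
    (hf : Continuous f) (h : IsReturnCenter f c n m z) (hno : ¬ HasOneSidedHorseshoe f) {i j : ℕ}
    (hi : IsInnerLeft f z {x | ∃ i < n, f^[i] c = x} (f^[i] c)) (hij : i + j ≤ n) :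
    (Even j → IsInnerLeft f z {x | ∃ i < n, f^[i] c = x} (f^[i + j] c)) ∧
      (Odd j → IsInnerRight f z {x | ∃ i < n, f^[i] c = x} (f^[i + j] c)) := by
  obtain ⟨hnoLeft, hnoRight⟩ := not_or.1 hno
  induction j with
  | zero => exact ⟨fun _ => hi, fun h => absurd h Nat.not_odd_zero⟩
  | succ j ih =>
    obtain ⟨ihL, ihR⟩ := ih (by lia)
    have hmem : f^[i + j] c ∈ {x | ∃ i < n, f^[i] c = x} := ⟨i + j, hij, rfl⟩
    have hne := h.ne_center (i + j + 1) hij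
    rw [Nat.even_add_one, Nat.odd_add_one, Nat.not_even_iff_odd, Nat.not_odd_iff_even, ← add_assoc]
    rw [Function.iterate_succ_apply'] at hne ⊢
    exact ⟨fun hj => (ihR hj).isInnerLeft_map hf h.map_eq hnoLeft hmem hne,
      fun hj => (ihL hj).isInnerRight_map hf h.map_eq hnoRight hmem hne⟩

variable {X : Type*} [CompleteLinearOrder X] [DenselyOrdered X] [TopologicalSpace X]
  [OrderTopology X] {f : X → X} {c : X} {n : ℕ}

theorem hasOneSidedHorseshoe_of_odd_return_le (hf : Continuous f) (hn : Odd n)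
    (hle : f^[n] c ≤ c) (hlt : c < f c) : HasOneSidedHorseshoe f := by
  by_contra hno
  obtain ⟨m, z, hcm, h⟩ := exists_isReturnCenter hf hn.pos hle hlt
  have hnz : f^[n] c < z := (hle.trans hcm).trans_lt h.lt_center
  have hadd := Nat.add_sub_cancel' h.lt_length.le
  have hrun := h.isInner_iterate_add hf hno (h.isInnerLeft_center hnz) hadd.le
  rw [hadd] at hrun
  have hend : IsInnerLeft f z {x | ∃ i < n, f^[i] c = x} (f^[n] c) := by
    rcases Nat.even_or_odd (n - m) with heven | hodd
    exacts [hrun.1 heven, absurd (hrun.2 hodd).1 hnz.not_gt]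
  have hstart : IsInnerLeft f z {x | ∃ i < n, f^[i] c = x} (f^[0] c) := by
    refine ⟨hcm.trans_lt h.lt_center, fun v hv hvz hfv => (hend.2.1 v hv hvz hfv).trans_le hle,
      fun w hw hzw hfw => ?_⟩
    obtain ⟨u, hzu, huw, hfu⟩ := hend.2.2 w hw hzw hfw
    exact ⟨u, hzu, huw, hfu.trans hle⟩
  have hright := (h.isInner_iterate_add hf hno hstart (zero_add n).le).2 hn
  rw [zero_add] at hright
  exact lt_asymm hnz hright.1

theorem hasOneSidedHorseshoe_of_le_odd_return (hf : Continuous f) (hn : Odd n)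
    (hle : c ≤ f^[n] c) (hlt : f c < c) : HasOneSidedHorseshoe f :=
  (hasOneSidedHorseshoe_of_odd_return_le (X := Xᵒᵈ) hf hn hle hlt).of_orderDual

end OddReturn

section Return

theorem hasLeftHorseshoe_of_returning_path {X : Type*} [LinearOrder X] {f : X → X} {z b : X}
    {p : ℕ → X} {k : ℕ} (hk : 1 ≤ k) (hdown : p 1 < p 0) (hstart : f (f (p 0)) ≤ p 1)
    (hstep : ∀ i, 1 ≤ i → i < k → p (i + 1) = f (f (p i))) (hbelow : ∀ i < k, p i < b)
    (hover : ∀ i < k, z ≤ f (p i)) (hbz : b ≤ z) (hzb : z ≤ f b) (hb : b ≤ f (f b))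
    (hend : b ≤ p k) : HasLeftHorseshoe f := by
  induction k, hk using Nat.le_induction generalizing b with
  | base => exact absurd (hdown.trans (hbelow 0 one_pos)) hend.not_gt
  | succ k hk ih =>
    have hkb : p k < b := hbelow k k.lt_succ_self
    have hjump : b ≤ f (f (p k)) := hstep k hk k.lt_succ_self ▸ hend
    by_cases hfall : ∃ j < k, p k < p j ∧ f (f (p j)) ≤ p k
    · obtain ⟨j, hj, hkj, hfj⟩ := hfall
      exact ⟨p k, p j, b, z, hkj, hbelow j (by lia), hbz, hover k (by lia), hover j (by lia), hzb,
        hjump, hb, hfj⟩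
    -- No point above `p k` falls to it, so `p k` is above the earlier points of the path, and a
    -- shorter path returns to it.
    push Not at hfall
    have hnext : ∀ j < k, f (f (p j)) ≤ p (j + 1) := fun j hj => by
      rcases j.eq_zero_or_pos with rfl | hpos
      exacts [hstart, (hstep j hpos (by lia)).ge]
    have hle : ∀ j < k, p j ≤ p k := fun j hj => le_of_not_gt fun hlt => by
      have hstay : ∀ i, j ≤ i → i ≤ k → p k < p i := fun i hji => by
        induction i, hji using Nat.le_induction with
        | base => exact fun _ => hlt
        | succ i _ hi => exact fun hik => (hfall i hik (hi (by lia))).trans_le (hnext i hik)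
      exact lt_irrefl _ (hstay k hj.le le_rfl)
    have hlt : ∀ j < k, p j < p k := fun j hj => (hle j hj).lt_of_ne fun heq =>
      ((hjump.trans_eq (by rw [heq])).trans (hnext j hj)).not_gt (hbelow (j + 1) (by lia))
    exact ih (fun i hi hik => hstep i hi (by lia)) hlt (fun i hi => hover i (by lia))
      (hkb.le.trans hbz) (hover k (by lia)) (hkb.le.trans hjump) le_rfl

end Return

section ReturnLimit

theorem frequently_le_and_lt_of_decreasing {X : Type*} [LinearOrder X] {x : ℕ → X} {e z : X}
    (hez : e < z) (hdecr : ∀ n, e < x n → x (n + 1) < x n) (hbelow : ∀ n, x n < z)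
    (hlim : ∀ l < z, ∃ n, l < x n) {l : X} (hl : l < z) :
    ∃ᶠ n in atTop, x (n + 1) ≤ e ∧ l < x (n + 2) := by
  refine frequently_atTop.2 fun N => ?_
  classical
  obtain ⟨m, hm, hmax⟩ := (insert l (insert e ((Finset.range (N + 2)).image x))).exists_max_image id
    ⟨l, Finset.mem_insert_self _ _⟩
  simp only [Finset.mem_insert, Finset.mem_image, Finset.mem_range, id_eq, forall_eq_or_imp,
    forall_exists_index, and_imp, forall_apply_eq_imp_iff₂] at hm hmax
  obtain ⟨hlm, hem, hxm⟩ := hmax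
  have hmz : m < z := by
    rcases hm with rfl | rfl | ⟨i, -, rfl⟩
    exacts [hl, hez, hbelow i]
  have hhit := hlim m hmz
  obtain ⟨n, hn⟩ := Nat.exists_eq_add_of_le
    (le_of_not_gt fun hlt => (Nat.find_spec hhit).not_ge (hxm _ hlt))
  have hspec := Nat.find_spec hhit
  have hmin : x (N + n + 1) ≤ m := le_of_not_gt (Nat.find_min hhit (by lia))
  rw [hn, show N + 2 + n = N + n + 2 by ring] at hspec
  refine ⟨N + n, by lia, le_of_not_gt fun h => ?_, hlm.trans_lt hspec⟩
  exact (hdecr _ h).not_ge (hmin.trans hspec.le)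

theorem sq_lt_of_return_limit {X : Type*} [LinearOrder X] {f : X → X} {x : ℕ → X} {e z : X}
    (hno : ¬ HasLeftHorseshoe f) (hstart : f (f e) ≤ x 0) (hxe : x 0 < e) (hze : z ≤ f e)
    (hstep : ∀ n, x (n + 1) = f (f (x n))) (hover : ∀ n, z ≤ f (x n))
    (hlim : ∀ l < z, ∃ n, l < x n) {t : X} (het : e < t) (htz : t < z) (hzt : z ≤ f t) :
    f (f t) < t := by
  classical
  refine lt_of_not_ge fun ht => hno ?_
  have hhit := (hlim t htz).imp fun _ => le_of_lt
  have hpos : ∀ i, i < Nat.find hhit → x i < t := fun i hi => lt_of_not_ge (Nat.find_min hhit hi)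
  refine hasLeftHorseshoe_of_returning_path (p := fun n => Nat.casesOn n e x)
    (k := Nat.find hhit + 1) (by lia) hxe hstart ?_ ?_ ?_ htz.le hzt ht (Nat.find_spec hhit)
  · rintro (_ | i) hi _
    exacts [absurd hi (by lia), hstep i]
  · rintro (_ | i) hi
    exacts [het, hpos i (by lia)]
  · rintro (_ | i) _
    exacts [hze, hover i]

theorem exists_ultrafilter_tendsto {X : Type*} [LinearOrder X] [TopologicalSpace X]
    [OrderTopology X] {x : ℕ → X} {P : ℕ → Prop} {z : X} (hbelow : ∀ n, x n < z)
    (h : ∀ l < z, ∃ᶠ n in atTop, P n ∧ l < x n) :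
    ∃ U : Ultrafilter ℕ, ↑U ≤ (atTop : Filter ℕ) ∧ (∀ᶠ n in U, P n) ∧ Tendsto x U (𝓝 z) := by
  have hcluster : MapClusterPt z (atTop ⊓ 𝓟 {n | P n}) x := by
    refine mapClusterPt_iff_frequently.2 fun s hs => ?_
    rw [frequently_inf_principal]
    obtain ⟨l, hl, hls⟩ := exists_Ioc_subset_of_mem_nhds hs ⟨x 0, hbelow 0⟩
    exact (h l hl).mono fun n hn => ⟨hn.1, hls ⟨hn.2, (hbelow n).le⟩⟩
  obtain ⟨U, hU, hlim⟩ := mapClusterPt_iff_ultrafilter.1 hcluster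
  exact ⟨U, hU.trans inf_le_left, hU (mem_inf_of_right (mem_principal_self _)), hlim⟩

theorem hasLeftHorseshoe_of_return_limit {X : Type*} [CompleteLinearOrder X]
    [TopologicalSpace X] [OrderTopology X] {f : X → X} (hf : Continuous f) {x : ℕ → X} {e z : X}
    (hz : f z = z) (hstart : f (f e) ≤ x 0) (hxe : x 0 < e) (hez : e < z) (hze : z ≤ f e)
    (hstep : ∀ n, x (n + 1) = f (f (x n))) (hbelow : ∀ n, x n < z) (hover : ∀ n, z ≤ f (x n))
    (hlim : ∀ l < z, ∃ n, l < x n) : HasLeftHorseshoe f := by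
  by_contra hno
  have hdecr : ∀ n, e < x n → x (n + 1) < x n := fun n hn => by
    rw [hstep]
    exact sq_lt_of_return_limit hno hstart hxe hze hstep hover hlim hn (hbelow n) (hover n)
  obtain ⟨U, hU, hUe, hUz⟩ := exists_ultrafilter_tendsto (fun n => hbelow (n + 2))
    fun l hl => frequently_le_and_lt_of_decreasing hez hdecr hbelow hlim hl
  -- Along `U` the orbit passes near `q`, drops to `e` or below, and then jumps up to `z`.
  set q := (U.map x).lim
  have hq : Tendsto x U (𝓝 q) := (U.map x).le_nhds_lim
  have hsq : Continuous fun t => f (f t) := hf.comp hf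
  have hq₁ : Tendsto (fun n => x (n + 1)) U (𝓝 (f (f q))) := by
    simpa only [hstep, Function.comp_def] using (hsq.tendsto q).comp hq
  have hq₂ : f (f (f (f q))) = z :=
    tendsto_nhds_unique
      (by simpa only [hstep, Function.comp_def] using (hsq.tendsto _).comp hq₁) hUz
  have hover' : z ≤ f q := ge_of_tendsto' ((hf.tendsto q).comp hq) hover
  have hover₁ : z ≤ f (f (f q)) := ge_of_tendsto' ((hf.tendsto _).comp hq₁) fun n => hover _
  have hqe : f (f q) < z := (le_of_tendsto hq₁ hUe).trans_lt hez
  have hstay : ∀ n, f (f q) < x n → f (f q) < x (n + 1) := fun n hn => lt_of_not_ge fun hle =>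
    hno ⟨_, x n, z, z, hn, hbelow n, le_rfl, hover₁, hover n, hz.ge, hq₂.ge, by rw [hz, hz],
      hstep n ▸ hle⟩
  have hle : f (f q) ≤ q := by
    obtain ⟨N, hN⟩ := hlim _ hqe
    refine ge_of_tendsto hq ((eventually_ge_atTop N).filter_mono hU |>.mono fun n hn => le_of_lt ?_)
    induction n, hn using Nat.le_induction with
    | base => exact hN
    | succ n _ ih => exact hstay n ih
  have hlt : f (f q) < q := hle.lt_of_ne fun h => hqe.ne (by rw [← hq₂, h, h])
  have hqz : q < z := (le_of_tendsto' hq fun n => (hbelow n).le).lt_of_ne fun h =>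
    hqe.ne (by rw [h, hz, hz])
  exact hno ⟨f (f q), q, z, z, hlt, hqz, le_rfl, hover₁, hover', hz.ge, hq₂.ge, by rw [hz, hz],
    le_rfl⟩

end ReturnLimit

section Proximal

variable {X : Type*} [MetricSpace X] [CompactSpace X]

theorem isBoundedUnder_le_dist (u v : ℕ → X) :
    IsBoundedUnder (· ≤ ·) atTop fun n => dist (u n) (v n) :=
  isBoundedUnder_of ⟨Metric.diam univ, fun _ =>
    Metric.dist_le_diam_of_mem isCompact_univ.isBounded (mem_univ _) (mem_univ _)⟩

theorem frequently_dist_lt_of_liminf_eq_zero {u v : ℕ → X}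
    (h : liminf (fun n => dist (u n) (v n)) atTop = 0) {ε : ℝ} (hε : 0 < ε) :
    ∃ᶠ n in atTop, dist (u n) (v n) < ε :=
  frequently_lt_of_liminf_lt (isBoundedUnder_le_dist u v).isCoboundedUnder_ge (h ▸ hε)

theorem notMem_proximalPairs_of_forall_mem {f : X → X} {E : Set (X × X)} (hE : IsClosed E)
    (hdiag : ∀ p ∈ E, p.1 ≠ p.2) {u v : X} (h : ∀ n, (f^[n] u, f^[n] v) ∈ E) :
    (u, v) ∉ proximalPairs f := fun hprox => by
  obtain ⟨p, hp, hmin⟩ := hE.isCompact.exists_isMinOn ⟨_, h 0⟩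
    (continuous_dist (α := X)).continuousOn
  obtain ⟨n, hn⟩ :=
    (frequently_dist_lt_of_liminf_eq_zero hprox (dist_pos.2 (hdiag p hp))).exists
  exact hn.not_ge (hmin (h n))

end Proximal

section Alternating

/-- The orbit of `y` alternates around `z`, starting on the left. Non-convergent orbits end up
like this when there is no one-sided horseshoe. -/
def Alternates {X : Type*} [Preorder X] (f : X → X) (z y : X) : Prop :=
  ∀ n, f^[2 * n] y < z ∧ z < f^[2 * n + 1] y

theorem iterate_two_mul_succ_apply {X : Type*} (f : X → X) (n : ℕ) (y : X) :
    f^[2 * (n + 1)] y = f (f (f^[2 * n] y)) := by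
  rw [mul_add_one, Function.iterate_succ_apply', Function.iterate_succ_apply']

theorem Alternates.iterate {X : Type*} [Preorder X] {f : X → X} {z y : X} (h : Alternates f z y)
    (k : ℕ) : Alternates f z (f^[2 * k] y) := fun n => by
  rw [← Function.iterate_add_apply, ← Function.iterate_add_apply, ← mul_add, add_right_comm,
    ← mul_add]
  exact h (n + k)

theorem tendsto_of_tendsto_even_odd {α : Type*} {l : Filter α} {x : ℕ → α}
    (heven : Tendsto (fun n => x (2 * n)) atTop l)
    (hodd : Tendsto (fun n => x (2 * n + 1)) atTop l) : Tendsto x atTop l := by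
  refine tendsto_def.2 fun s hs => ?_
  have hs' : ∀ᶠ n in atTop, x (2 * n) ∈ s := heven hs
  obtain ⟨M, hM⟩ := eventually_atTop.1 (hs'.and (hodd hs))
  filter_upwards [eventually_ge_atTop (2 * M)] with n hn
  obtain ⟨k, rfl | rfl⟩ := Nat.even_or_odd' n
  exacts [(hM k (by lia)).1, (hM k (by lia)).2]

theorem tendsto_iterate_of_tendsto_even {X : Type*} [TopologicalSpace X] {f : X → X}
    (hf : Continuous f) {z y : X} (hz : f z = z)
    (h : Tendsto (fun n => f^[2 * n] y) atTop (𝓝 z)) : Tendsto (fun n => f^[n] y) atTop (𝓝 z) := by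
  refine tendsto_of_tendsto_even_odd h ?_
  simpa only [Function.comp_def, ← Function.iterate_succ_apply', hz] using (hf.tendsto z).comp h

theorem lt_iff_lt_of_forall_ne {X Y : Type*} [ConditionallyCompleteLinearOrder X] [DenselyOrdered X]
    [TopologicalSpace X] [OrderTopology X] [LinearOrder Y] [TopologicalSpace Y]
    [OrderClosedTopology Y] {g : X → Y} (hg : Continuous g) {a b : X} {z : Y}
    (hne : ∀ t ∈ Icc a b, g t ≠ z) {s t : X} (hs : s ∈ Icc a b) (ht : t ∈ Icc a b) :
    g s < z ↔ g t < z := by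
  wlog h : g s < z ∧ z ≤ g t generalizing s t
  · by_contra hiff
    rw [not_iff] at hiff
    grind
  obtain ⟨r, hr, hrz⟩ := isPreconnected_Icc.intermediate_value hs ht hg.continuousOn ⟨h.1.le, h.2⟩
  exact absurd hrz (hne r hr)

variable {X : Type*} [CompleteLinearOrder X] {f : X → X} {z y : X}

theorem Alternates.exists_upper_bound [TopologicalSpace X] [OrderTopology X] (hf : Continuous f)
    (hno : ¬ HasLeftHorseshoe f) (hz : f z = z) {e : X} (he : Alternates f z e)
    (hy : Alternates f z y) (hstart : f (f e) ≤ y) (hye : y < e) :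
    ∃ l < z, ∀ n, f^[2 * n] y ≤ l := by
  by_contra! hlim
  exact hno (hasLeftHorseshoe_of_return_limit hf (x := fun n => f^[2 * n] y) hz hstart hye (he 0).1
    (he 0).2.le (fun n => iterate_two_mul_succ_apply f n y) (fun n => (hy n).1)
    (fun n => by simpa only [← Function.iterate_succ_apply'] using (hy n).2.le) hlim)

theorem Alternates.tendsto [TopologicalSpace X] [OrderTopology X] (hf : Continuous f)
    (hno : ¬ HasLeftHorseshoe f) (hz : f z = z) (hy : Alternates f z y)
    (hlim : ∀ l < z, ∃ᶠ n in atTop, l < f^[2 * n] y) :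
    Tendsto (fun n => f^[n] y) atTop (𝓝 z) := by
  have hmono : Monotone fun n => f^[2 * n] y := monotone_nat_of_le_succ fun n => by
    refine le_of_not_gt fun hlt => ?_
    obtain ⟨l, hl, hle⟩ := (hy.iterate n).exists_upper_bound hf hno hz (hy.iterate (n + 1))
      (iterate_two_mul_succ_apply f n y).ge hlt
    obtain ⟨k, hk, hlk⟩ := frequently_atTop.1 (hlim l hl) (n + 1)
    refine hlk.not_ge ?_
    simpa only [← Function.iterate_add_apply, ← mul_add, Nat.sub_add_cancel hk]
      using hle (k - (n + 1))
  refine tendsto_iterate_of_tendsto_even hf hz (tendsto_order.2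
    ⟨fun l hl => ?_, fun l hl => Eventually.of_forall fun n => (hy n).1.trans hl⟩)
  obtain ⟨k, hk⟩ := (hlim l hl).exists
  filter_upwards [eventually_ge_atTop k] with n hn
  exact hk.trans_le (hmono hn)

variable [DenselyOrdered X]

theorem Alternates.iterate_ne [TopologicalSpace X] [OrderTopology X] (hf : Continuous f)
    (hno : ¬ HasLeftHorseshoe f) (hz : f z = z) (hy : Alternates f z y) (hstep : f (f y) ≤ y)
    (j : ℕ) : ∀ t ∈ Icc (f (f y)) y, f^[j] t ≠ z := by
  induction j using Nat.strong_induction_on with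
  | _ j ih =>
  intro t ht htz
  have hy' : y ∈ Icc (f (f y)) y := right_mem_Icc.2 hstep
  have hbelow : ∀ i, 2 * i < j → f^[2 * i] t < z := fun i hi =>
    (lt_iff_lt_of_forall_ne (hf.iterate _) (ih _ hi) hy' ht).1 (hy i).1
  have hover : ∀ i, 2 * i < j → z ≤ f^[2 * i + 1] t := fun i hi => by
    rcases (Nat.succ_le_of_lt hi).eq_or_lt with rfl | hlt
    · exact htz.ge
    · exact le_of_not_gt fun h => (hy i).2.not_gt
        ((lt_iff_lt_of_forall_ne (hf.iterate _) (ih _ hlt) ht hy').1 h)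
  have hne : f^[j] y ≠ z := by
    rcases Nat.even_or_odd' j with ⟨k, rfl | rfl⟩
    exacts [(hy k).1.ne, (hy k).2.ne']
  have hend : f^[2 * ((j + 1) / 2)] t = z := by
    have : Function.IsFixedPt f (f^[j] t) := by rw [htz]; exact hz
    rw [iterate_eq_of_isFixedPt_iterate (by lia) this, htz]
  refine hno (hasLeftHorseshoe_of_returning_path (z := z) (b := z)
    (p := fun n => Nat.casesOn n y fun i => f^[2 * i] t) (k := (j + 1) / 2 + 1) (by lia)
    (ht.2.lt_of_ne fun h => hne (h ▸ htz)) ht.1 ?_ ?_ ?_ le_rfl hz.ge (by rw [hz, hz]) hend.ge)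
  · rintro (_ | i) hi _
    exacts [absurd hi (by lia), iterate_two_mul_succ_apply f i t]
  · rintro (_ | i) hi
    exacts [(hy 0).1, hbelow i (by lia)]
  · rintro (_ | i) hi
    exacts [(hy 0).2.le, (hover i (by lia)).trans_eq (Function.iterate_succ_apply' ..)]

theorem Alternates.of_mem_Icc [TopologicalSpace X] [OrderTopology X] (hf : Continuous f)
    (hno : ¬ HasLeftHorseshoe f) (hz : f z = z) (hy : Alternates f z y) {t : X}
    (ht : t ∈ Icc (f (f y)) y) : Alternates f z t := fun n => by
  have hstep := ht.1.trans ht.2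
  have hne := hy.iterate_ne hf hno hz hstep
  have hside := fun j => lt_iff_lt_of_forall_ne (hf.iterate j) (hne j) ht (right_mem_Icc.2 hstep)
  exact ⟨(hside _).2 (hy n).1, lt_of_le_of_ne
    (le_of_not_gt fun h => (hy n).2.not_gt ((hside _).1 h)) (hne _ t ht).symm⟩

theorem Alternates.notMem_proximalPairs [MetricSpace X] [OrderTopology X] (hf : Continuous f)
    (hno : ¬ HasLeftHorseshoe f) (hz : f z = z) (hy : Alternates f z y) {u w : X}
    (hu : u ∈ Ico (f (f y)) y) (hw : w ∈ uIcc (f (f (f y))) (f y)) : (u, w) ∉ proximalPairs f := by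
  obtain ⟨v, hv, rfl⟩ := intermediate_value_uIcc (a := f (f y)) hf.continuousOn hw
  rw [uIcc_of_le (hu.1.trans hu.2.le)] at hv
  have hualt := hy.of_mem_Icc hf hno hz (Ico_subset_Icc_self hu)
  have hvalt := hy.of_mem_Icc hf hno hz hv
  obtain ⟨l, hl, hul⟩ := hy.exists_upper_bound hf hno hz hualt hu.1 hu.2
  refine notMem_proximalPairs_of_forall_mem
    (E := {p | p.1 ≤ l ∧ z ≤ p.2} ∪ {p | z ≤ p.1 ∧ f p.1 ≤ l ∧ p.2 ≤ z}) ?_ ?_ fun n => ?_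
  · refine IsClosed.union ?_ ?_
    · exact (isClosed_le continuous_fst continuous_const).inter
        (isClosed_le continuous_const continuous_snd)
    · exact (isClosed_le continuous_const continuous_fst).inter
        ((isClosed_le (hf.comp continuous_fst) continuous_const).inter
          (isClosed_le continuous_snd continuous_const))
  · rintro p (⟨hp, hzp⟩ | ⟨hzp, hfp, hp⟩) heq
    · exact (hp.trans_lt hl).not_ge (heq ▸ hzp)
    · obtain rfl : p.1 = z := le_antisymm (heq ▸ hp) hzp
      exact hl.not_ge (hz.ge.trans hfp)
  · obtain ⟨k, rfl | rfl⟩ := Nat.even_or_odd' n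
    · exact .inl ⟨hul k, (hvalt k).2.le⟩
    · exact .inr ⟨(hualt k).2.le,
        (Function.iterate_succ_apply' f (2 * k + 1) u).ge.trans (hul (k + 1)),
        (hvalt (k + 1)).1.le⟩

end Alternating

section Division

/-- The sequence `x` moves up on the left of `z` and down on the right of `z`, the behaviour of a
non-convergent orbit when there is no one-sided horseshoe. -/
def IsDividedBy {X : Type*} [Preorder X] (x : ℕ → X) (z : X) : Prop :=
  ∀ n, (x n < z ∧ x n < x (n + 1)) ∨ (z < x n ∧ x (n + 1) < x n)

section Order

variable {X : Type*} [LinearOrder X] {x : ℕ → X} {z : X}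

theorem IsDividedBy.ne (h : IsDividedBy x z) (n : ℕ) : x n ≠ z :=
  (h n).elim (fun h => h.1.ne) fun h => h.1.ne'

theorem IsDividedBy.lt_succ (h : IsDividedBy x z) {n : ℕ} (hn : x n < z) : x n < x (n + 1) :=
  (h n).elim And.right fun h => absurd h.1 hn.not_gt

end Order

theorem IsDividedBy.tendsto {X : Type*} [LinearOrder X] [TopologicalSpace X] [OrderTopology X]
    {f : X → X} (hf : Continuous f) {x : ℕ → X} {z : X} (hx : ∀ n, x (n + 1) = f (x n))
    (hz : f z = z) (hdiv : IsDividedBy x z) (hleft : ∃ n, x n < z)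
    (h : ∀ l < z, ∃ i, x i < z ∧ ∀ j ≥ i, l < x j) : Tendsto x atTop (𝓝 z) := by
  refine tendsto_order.2 ⟨fun l hl => ?_, fun r hr => ?_⟩
  · obtain ⟨i, -, hi⟩ := h l hl
    exact eventually_atTop.2 ⟨i, hi⟩
  obtain ⟨n, hn⟩ := hleft
  obtain ⟨l, hl, hlr⟩ := exists_Ioc_subset_of_mem_nhds
    (hf.continuousAt.eventually (gt_mem_nhds (hz.trans_lt hr))) ⟨x n, hn⟩
  obtain ⟨i, hiz, hi⟩ := h l hl
  refine eventually_atTop.2 ⟨i, fun j hj => ?_⟩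
  induction j, hj using Nat.le_induction with
  | base => exact hiz.trans hr
  | succ j hj ih =>
    rcases hdiv j with ⟨hjz, -⟩ | ⟨-, hdown⟩
    · exact (hx j).trans_lt (hlr ⟨hi j hj, hjz.le⟩)
    · exact hdown.trans ih

theorem eventually_lt_of_map_lt {X : Type*} [LinearOrder X] [TopologicalSpace X] [OrderTopology X]
    {f : X → X} (hf : Continuous f) {x : ℕ → X} {a s z : X} (hx : ∀ n, x (n + 1) = f (x n))
    (hs : f s < z) (hle : ∀ n, x n < z → x n ≤ s) (ha : a < s)
    (h : ∀ l < s, ∃ i, x i < z ∧ ∀ j ≥ i, l < x j) : ∀ᶠ n in atTop, x n < z := by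
  obtain ⟨l, hl, hls⟩ := exists_Ioc_subset_of_mem_nhds
    (hf.continuousAt.eventually (gt_mem_nhds hs)) ⟨a, ha⟩
  obtain ⟨i, hiz, hi⟩ := h l hl
  refine eventually_atTop.2 ⟨i, fun j hj => ?_⟩
  induction j, hj using Nat.le_induction with
  | base => exact hiz
  | succ j hj ih => exact (hx j).trans_lt (hls ⟨hi j hj, hle j ih⟩)

theorem IsDividedBy.lt_of_lt {X : Type*} [ConditionallyCompleteLinearOrder X] [DenselyOrdered X]
    [TopologicalSpace X] [OrderTopology X] {f : X → X} {x : ℕ → X} {z v : X} (hf : Continuous f)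
    (hno : ¬ HasLeftHorseshoe f) (hx : ∀ n, x (n + 1) = f (x n)) (hz : f z = z)
    (hdiv : IsDividedBy x z) (hfv : f v ≤ z) {i j : ℕ} (hi : v < x i) (hiz : x i < z)
    (hij : i ≤ j) : v < x j := by
  suffices hinv : v < x j ∧ (z < x j → ∃ u, v < u ∧ u < z ∧ x j ≤ f u) from hinv.1
  induction j, hij using Nat.le_induction with
  | base => exact ⟨hi, fun h => absurd h hiz.not_gt⟩
  | succ j _ ih =>
    obtain ⟨hvj, hjump⟩ := ih
    rcases hdiv j with ⟨hjz, hup⟩ | ⟨hzj, hdown⟩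
    · exact ⟨hvj.trans hup, fun _ => ⟨x j, hvj, hjz, (hx j).le⟩⟩
    · obtain ⟨u, hvu, huz, hju⟩ := hjump hzj
      refine ⟨lt_of_not_ge fun hle => ?_, fun _ => ⟨u, hvu, huz, hdown.le.trans hju⟩⟩
      exact hno (hasLeftHorseshoe_of_jump hf hz hvu huz hfv hzj hju (hx j ▸ hle))

theorem exists_tendsto_of_eventually_le {X : Type*} [CompleteLinearOrder X] [TopologicalSpace X]
    [OrderTopology X] {x : ℕ → X} (h : ∀ᶠ n in atTop, x n ≤ x (n + 1)) :
    ∃ p, Tendsto x atTop (𝓝 p) := by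
  obtain ⟨N, hN⟩ := eventually_atTop.1 h
  have hmono : Monotone fun n => x (n + N) := monotone_nat_of_le_succ fun n => by
    rw [add_right_comm]
    exact hN _ (Nat.le_add_left N n)
  exact ⟨_, (tendsto_add_atTop_iff_nat N).1 (tendsto_atTop_iSup hmono)⟩

theorem exists_fixedPt_between {X : Type*} [CompleteLinearOrder X] [DenselyOrdered X]
    [TopologicalSpace X] [OrderTopology X] {f : X → X} (hf : Continuous f) {U D : Set X}
    (hU : U.Nonempty) (hD : D.Nonempty) (hUD : ∀ u ∈ U, ∀ d ∈ D, u ≤ d) (hup : ∀ u ∈ U, u ≤ f u)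
    (hdown : ∀ d ∈ D, f d ≤ d) : ∃ z, f z = z ∧ (∀ u ∈ U, u ≤ z) ∧ ∀ d ∈ D, z ≤ d := by
  have hsup : sSup U ≤ f (sSup U) :=
    closure_minimal hup (isClosed_le continuous_id hf) (sSup_mem_closure hU)
  have hinf : f (sInf D) ≤ sInf D :=
    closure_minimal hdown (isClosed_le hf continuous_id) (sInf_mem_closure hD)
  obtain ⟨z, hz, hfz, -⟩ := exists_first_eq_of_le continuous_id hf
    (sSup_le fun u hu => le_sInf (hUD u hu)) hsup hinf
  exact ⟨z, hfz.symm, fun u hu => (le_sSup hu).trans hz.1, fun d hd => hz.2.trans (sInf_le hd)⟩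

section Orbit

variable {X : Type*} [CompleteLinearOrder X] [DenselyOrdered X] [TopologicalSpace X]
  [OrderTopology X] {f : X → X} {x : ℕ → X} {z : X}

theorem lt_of_lt_succ_of_succ_lt (hf : Continuous f) (hno : ¬ HasOneSidedHorseshoe f)
    (hx : ∀ n, x (n + 1) = f (x n)) {i j : ℕ} (hi : x i < x (i + 1)) (hj : x (j + 1) < x j) :
    x i < x j := by
  have hadd : ∀ m n, x (m + n) = f^[n] (x m) := fun m n => by
    induction n with
    | zero => rfl
    | succ n ih => rw [← add_assoc, hx, ih, Function.iterate_succ_apply']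
  have hup : ∀ n, Odd n → x i < x (i + n) := fun n hn => lt_of_not_ge fun hle =>
    hno (hasOneSidedHorseshoe_of_odd_return_le hf hn (hadd i n ▸ hle) (hx i ▸ hi))
  have hdown : ∀ n, Odd n → x (j + n) < x j := fun n hn => lt_of_not_ge fun hle =>
    hno (hasOneSidedHorseshoe_of_le_odd_return hf hn (hadd j n ▸ hle) (hx j ▸ hj))
  rcases le_total i j with hij | hji
  · obtain ⟨n, rfl⟩ := Nat.exists_eq_add_of_le hij
    rcases n.even_or_odd with hn | hn
    exacts [(hup _ hn.add_one).trans hj, hup n hn]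
  · obtain ⟨n, rfl⟩ := Nat.exists_eq_add_of_le hji
    rcases n.even_or_odd with hn | hn
    exacts [hi.trans (hdown _ hn.add_one), hdown n hn]

theorem exists_isDividedBy (hf : Continuous f) (hno : ¬ HasOneSidedHorseshoe f)
    (hx : ∀ n, x (n + 1) = f (x n)) (hlim : ¬ ∃ p, Tendsto x atTop (𝓝 p)) :
    ∃ z, f z = z ∧ IsDividedBy x z ∧ (∃ᶠ n in atTop, x n < z) ∧ ∃ᶠ n in atTop, z < x n := by
  have hup : ∃ᶠ n in atTop, x n < x (n + 1) := fun h =>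
    hlim (exists_tendsto_of_eventually_le (X := Xᵒᵈ) (h.mono fun n hn => le_of_not_gt hn))
  have hdown : ∃ᶠ n in atTop, x (n + 1) < x n := fun h =>
    hlim (exists_tendsto_of_eventually_le (h.mono fun n hn => le_of_not_gt hn))
  have hmove : ∀ n, x (n + 1) ≠ x n := fun n hn => hlim ⟨x n, tendsto_const_nhds.congr' <|
    eventually_atTop.2 ⟨n, fun m hm => by
      induction m, hm using Nat.le_induction with
      | base => rfl
      | succ m _ ih => rw [hx, ← ih, ← hx, hn]⟩⟩
  obtain ⟨z, hz, hUz, hzD⟩ := exists_fixedPt_between hf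
    (U := x '' {n | x n < x (n + 1)}) (D := x '' {n | x (n + 1) < x n})
    (Nonempty.image _ hup.exists) (Nonempty.image _ hdown.exists)
    (forall_mem_image.2 fun i hi => forall_mem_image.2 fun j hj =>
      (lt_of_lt_succ_of_succ_lt hf hno hx hi hj).le)
    (forall_mem_image.2 fun i hi => hx i ▸ hi.le) (forall_mem_image.2 fun i hi => hx i ▸ hi.le)
  have hne : ∀ n, x n ≠ z := fun n h => hmove n (by rw [hx, h, hz])
  have hleft : ∀ n, x n < x (n + 1) → x n < z := fun n hn =>
    (hUz _ (mem_image_of_mem x hn)).lt_of_ne (hne n)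
  have hright : ∀ n, x (n + 1) < x n → z < x n := fun n hn =>
    (hzD _ (mem_image_of_mem x hn)).lt_of_ne (hne n).symm
  exact ⟨z, hz, fun n => (hmove n).symm.lt_or_gt.imp (fun h => ⟨hleft n h, h⟩)
    fun h => ⟨hright n h, h⟩, hup.mono hleft, hdown.mono hright⟩

theorem IsDividedBy.eventually_not_both_lt (hf : Continuous f) (hno : ¬ HasLeftHorseshoe f)
    (hx : ∀ n, x (n + 1) = f (x n)) (hz : f z = z) (hdiv : IsDividedBy x z)
    (hright : ∃ᶠ n in atTop, z < x n) (hlim : ¬ Tendsto x atTop (𝓝 z)) :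
    ∀ᶠ n in atTop, ¬ (x n < z ∧ x (n + 1) < z) := by
  refine not_frequently.1 fun hsame => ?_
  set S := x '' {n | x n < z ∧ x (n + 1) < z}
  have hmem : sSup S ∈ closure S := sSup_mem_closure (Nonempty.image _ hsame.exists)
  have hle : ∀ n, x n < z → x (n + 1) < z → x n ≤ sSup S := fun n h h' =>
    le_sSup (mem_image_of_mem x ⟨h, h'⟩)
  have htail : ∀ l < sSup S, ∃ i, x i < z ∧ ∀ j ≥ i, l < x j := fun l hl => by
    obtain ⟨_, ⟨i, ⟨hi, hi'⟩, rfl⟩, hli⟩ := lt_sSup_iff.1 hl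
    refine ⟨i, hi, fun j hj => ?_⟩
    rcases hj.eq_or_lt with rfl | hlt
    · exact hli
    · exact hli.trans (hdiv.lt_of_lt hf hno hx hz (hx i ▸ hi'.le) (hdiv.lt_succ hi) hi' hlt)
  rcases (sSup_le (forall_mem_image.2 fun n hn => hn.1.le) : sSup S ≤ z).eq_or_lt with heq | hlt
  · exact hlim (hdiv.tendsto hf hx hz (hsame.exists.imp fun n hn => hn.1)
      fun l hl => htail l (heq ▸ hl))
  have hfle : f (sSup S) ≤ z := closure_minimal (t := {t | f t ≤ z})
    (forall_mem_image.2 fun n hn => (hx n).ge.trans hn.2.le) (isClosed_le hf continuous_const) hmem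
  have hleft : ∀ n, x n < z → x n ≤ sSup S := fun n hn => le_of_not_gt fun hlt' => by
    obtain ⟨j, hj, hjS⟩ := frequently_atTop.1 hsame n
    exact (hdiv.lt_of_lt hf hno hx hz hfle hlt' hn hj).not_ge (hle j hjS.1 hjS.2)
  have hflt : f (sSup S) < z := (closure_minimal (t := {t | f t ≤ sSup S})
    (forall_mem_image.2 fun n hn => (hx n).ge.trans (hleft _ hn.2))
    (isClosed_le hf continuous_const) hmem).trans_lt hlt
  obtain ⟨n, hn, hn'⟩ := hsame.exists
  exact hright ((eventually_lt_of_map_lt hf hx hflt hleft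
    ((hdiv.lt_succ hn).trans_le (hleft _ hn')) htail).mono fun n hn => hn.not_gt)

theorem exists_alternates_of_isDividedBy (hf : Continuous f) (hno : ¬ HasOneSidedHorseshoe f)
    {c : X} (hz : f z = z) (hdiv : IsDividedBy (fun n => f^[n] c) z)
    (hleft : ∃ᶠ n in atTop, f^[n] c < z) (hright : ∃ᶠ n in atTop, z < f^[n] c)
    (hlim : ¬ Tendsto (fun n => f^[n] c) atTop (𝓝 z)) : ∃ N, Alternates f z (f^[N] c) := by
  have hx : ∀ n, f^[n + 1] c = f (f^[n] c) := fun n => Function.iterate_succ_apply' f n c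
  obtain ⟨hnoLeft, hnoRight⟩ := not_or.1 hno
  have hL := hdiv.eventually_not_both_lt hf hnoLeft hx hz hright hlim
  have hR := IsDividedBy.eventually_not_both_lt (X := Xᵒᵈ) hf hnoRight hx hz
    (fun n => (hdiv n).symm) hleft hlim
  obtain ⟨M, hM⟩ := eventually_atTop.1 (hL.and hR)
  obtain ⟨N, hN, hNz⟩ := frequently_atTop.1 hleft M
  have hup : ∀ n ≥ M, f^[n] c < z → z < f^[n + 1] c := fun n hn h =>
    lt_of_le_of_ne (le_of_not_gt fun h' => (hM n hn).1 ⟨h, h'⟩) (hdiv.ne _).symm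
  have hdown : ∀ n ≥ M, z < f^[n] c → f^[n + 1] c < z := fun n hn h =>
    lt_of_le_of_ne (le_of_not_gt fun h' => (hM n hn).2 ⟨h, h'⟩) (hdiv.ne _)
  have heven : ∀ n, f^[2 * n + N] c < z := fun n => by
    induction n with
    | zero => simpa only [mul_zero, zero_add] using hNz
    | succ n ih =>
      rw [mul_add_one, add_right_comm]
      exact hdown _ (by lia) (hup _ (by lia) ih)
  refine ⟨N, fun n => ?_⟩
  rw [← Function.iterate_add_apply, ← Function.iterate_add_apply, add_right_comm]
  exact ⟨heven n, hup _ (by lia) (heven n)⟩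

theorem tendsto_or_alternates (hf : Continuous f) (hno : ¬ HasOneSidedHorseshoe f) (c : X) :
    (∃ p, Tendsto (fun n => f^[n] c) atTop (𝓝 p)) ∨
      ∃ z N, f z = z ∧ Alternates f z (f^[N] c) := by
  refine or_iff_not_imp_left.2 fun hlim => ?_
  obtain ⟨z, hz, hdiv, hleft, hright⟩ :=
    exists_isDividedBy hf hno (fun n => Function.iterate_succ_apply' f n c) hlim
  obtain ⟨N, hN⟩ := exists_alternates_of_isDividedBy hf hno hz hdiv hleft hright
    fun h => hlim ⟨z, h⟩
  exact ⟨z, N, hz, hN⟩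

end Orbit

end Division

section ClusterPoint

theorem Alternates.mem_uIcc_iterate {X : Type*} [LinearOrder X] {f : X → X} {z y : X}
    (h : Alternates f z y) (n : ℕ) : z ∈ uIcc (f^[n] y) (f (f^[n] y)) := by
  rw [← Function.iterate_succ_apply' f]
  obtain ⟨k, rfl | rfl⟩ := Nat.even_or_odd' n
  exacts [mem_uIcc.2 (.inl ⟨(h k).1.le, (h k).2.le⟩),
    mem_uIcc.2 (.inr ⟨(h (k + 1)).1.le, (h k).2.le⟩)]

theorem Alternates.eq_of_mapClusterPt {X : Type*} [LinearOrder X] [TopologicalSpace X]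
    [OrderTopology X] {f : X → X} (hf : Continuous f) {z z' y : X} (hz : f z = z)
    (hy : Alternates f z' y) (hc : MapClusterPt z atTop fun n => f^[n] y) : z' = z := by
  obtain ⟨U, -, hU⟩ := mapClusterPt_iff_ultrafilter.1 hc
  have hfU : Tendsto (fun n => f (f^[n] y)) U (𝓝 z) := by
    simpa only [Function.comp_def, hz] using (hf.tendsto z).comp hU
  refine le_antisymm ?_ ?_
  · simpa only [max_self] using le_of_tendsto_of_tendsto' tendsto_const_nhds (hU.max hfU)
      fun n => (hy.mem_uIcc_iterate n).2
  · simpa only [min_self] using le_of_tendsto_of_tendsto' (hU.min hfU) tendsto_const_nhds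
      fun n => (hy.mem_uIcc_iterate n).1

theorem frequently_lt_iterate_two_mul {X : Type*} [LinearOrder X] [TopologicalSpace X]
    [OrderTopology X] {f : X → X} (hf : Continuous f) {z y l : X} (hz : f z = z) (hl : l < z)
    (hc : MapClusterPt z atTop fun n => f^[n] y) : ∃ᶠ n in atTop, l < f^[2 * n] y := by
  have hnear : ∀ᶠ t in 𝓝 z, l < t ∧ l < f t :=
    (lt_mem_nhds hl).and (hf.continuousAt.eventually (lt_mem_nhds (hz.symm ▸ hl)))
  refine frequently_atTop.2 fun M => ?_
  obtain ⟨n, hn, hlt, hflt⟩ :=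
    frequently_atTop.1 (mapClusterPt_iff_frequently.1 hc _ hnear) (2 * M)
  obtain ⟨k, rfl | rfl⟩ := Nat.even_or_odd' n
  · exact ⟨k, by lia, hlt⟩
  · refine ⟨k + 1, by lia, ?_⟩
    rwa [mul_add_one, Function.iterate_succ_apply']

variable {X : Type*} [CompleteLinearOrder X] [DenselyOrdered X] [TopologicalSpace X]
  [OrderTopology X] {f : X → X} {z y c : X}

theorem tendsto_of_mapClusterPt (hf : Continuous f) (hno : ¬ HasOneSidedHorseshoe f)
    (hz : f z = z) (hc : MapClusterPt z atTop fun n => f^[n] c) :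
    Tendsto (fun n => f^[n] c) atTop (𝓝 z) := by
  rcases tendsto_or_alternates hf hno c with ⟨p, hp⟩ | ⟨z', N, hz', hy⟩
  · obtain ⟨U, hU, hlim⟩ := mapClusterPt_iff_ultrafilter.1 hc
    rwa [tendsto_nhds_unique hlim (hp.mono_left hU)]
  have hcN : MapClusterPt z atTop fun n => f^[n] (f^[N] c) := by
    rw [MapClusterPt, ← map_add_atTop_eq_nat N, Filter.map_map] at hc
    simpa only [MapClusterPt, Function.comp_def, Function.iterate_add_apply] using hc
  obtain rfl := hy.eq_of_mapClusterPt hf hz hcN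
  have hlim := hy.tendsto hf (fun h => hno (.inl h)) hz
    fun l hl => frequently_lt_iterate_two_mul hf hz hl hcN
  simp only [← Function.iterate_add_apply] at hlim
  exact (tendsto_add_atTop_iff_nat (f := fun n => f^[n] c) N).1 hlim

theorem hasOneSidedHorseshoe_of_mapClusterPt (hf : Continuous f) (hz : f z = z) (hyz : y ≠ z)
    (hcz : MapClusterPt z atTop fun n => f^[n] c) (hcy : MapClusterPt y atTop fun n => f^[n] c) :
    HasOneSidedHorseshoe f := by
  by_contra hno
  obtain ⟨U, hU, hlim⟩ := mapClusterPt_iff_ultrafilter.1 hcy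
  exact hyz (tendsto_nhds_unique hlim ((tendsto_of_mapClusterPt hf hno hz hcz).mono_left hU))

end ClusterPoint

section ConsecutiveDistance

theorem exists_isFixedPt_mapClusterPt {X : Type*} [MetricSpace X] [CompactSpace X] {f : X → X}
    (hf : Continuous f) {c : X}
    (h : ∀ ε > 0, ∃ᶠ n in atTop, dist (f^[n] c) (f^[n + 1] c) < ε) :
    ∃ z, f z = z ∧ MapClusterPt z atTop fun n => f^[n] c := by
  have hcl : MapClusterPt (0 : ℝ) atTop fun n => dist (f^[n] c) (f^[n + 1] c) := by
    refine mapClusterPt_iff_frequently.2 fun s hs => ?_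
    obtain ⟨ε, hε, hεs⟩ := Metric.mem_nhds_iff.1 hs
    refine (h ε hε).mono fun n hn => hεs ?_
    rwa [mem_ball_zero_iff, Real.norm_of_nonneg dist_nonneg]
  obtain ⟨U, hU, hdist⟩ := mapClusterPt_iff_ultrafilter.1 hcl
  obtain ⟨z, hz⟩ : ∃ z, Tendsto (fun n => f^[n] c) U (𝓝 z) :=
    ⟨_, (U.map fun n => f^[n] c).le_nhds_lim⟩
  refine ⟨z, ?_, mapClusterPt_iff_ultrafilter.2 ⟨U, hU, hz⟩⟩
  have hfz : Tendsto (fun n => f^[n + 1] c) U (𝓝 (f z)) := by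
    simpa only [Function.comp_def, ← Function.iterate_succ_apply'] using (hf.tendsto z).comp hz
  exact (dist_eq_zero.1 (tendsto_nhds_unique (hz.dist hfz) hdist)).symm

theorem hasOneSidedHorseshoe_of_limsup_liminf_dist {X : Type*} [CompleteLinearOrder X]
    [DenselyOrdered X] [MetricSpace X] [OrderTopology X] {f : X → X} (hf : Continuous f) {c : X}
    (hsup : 0 < limsup (fun n => dist (f^[n] c) (f^[n + 1] c)) atTop)
    (hinf : liminf (fun n => dist (f^[n] c) (f^[n + 1] c)) atTop = 0) :
    HasOneSidedHorseshoe f := by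
  by_contra hno
  obtain ⟨z, hz, hcz⟩ := exists_isFixedPt_mapClusterPt hf fun ε hε =>
    frequently_dist_lt_of_liminf_eq_zero (v := fun n => f^[n + 1] c) hinf hε
  have hlim := tendsto_of_mapClusterPt hf hno hz hcz
  have hdist := hlim.dist ((tendsto_add_atTop_iff_nat 1).2 hlim)
  rw [dist_self] at hdist
  exact hsup.ne' hdist.limsup_eq

end ConsecutiveDistance

section AsymptoticallyPeriodic

theorem iterate_two_mul_of_sq_eq {X : Type*} {f : X → X} {y : X} (hy : f (f y) = y) (n : ℕ) :
    f^[2 * n] y = y :=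
  Function.IsPeriodicPt.mul_const (m := 2) hy n

theorem IsAsymptPeriodicOneOrTwo.of_iterate {X : Type*} [PseudoMetricSpace X] {f : X → X} {x : X}
    {N : ℕ} (h : IsAsymptPeriodicOneOrTwo f (f^[N] x)) : IsAsymptPeriodicOneOrTwo f x := by
  obtain ⟨y, hy, hlim⟩ := h
  have hperiod : f (f (f^[N] y)) = f^[N] y := by
    rw [← Function.iterate_succ_apply' f, ← Function.iterate_succ_apply' f,
      Function.iterate_succ_apply, Function.iterate_succ_apply, hy]
  refine ⟨f^[N] y, hperiod, (tendsto_add_atTop_iff_nat N).1 (hlim.congr fun n => ?_)⟩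
  rw [Function.iterate_add_apply, Function.iterate_add_apply f n N (f^[N] y),
    ← Function.iterate_add_apply f N N, ← two_mul, iterate_two_mul_of_sq_eq hy]

theorem isAsymptPeriodicOneOrTwo_of_tendsto_even {X : Type*} [MetricSpace X] {f : X → X}
    (hf : Continuous f) {x p : X} (h : Tendsto (fun n => f^[2 * n] x) atTop (𝓝 p)) :
    IsAsymptPeriodicOneOrTwo f x := by
  have hp : f (f p) = p := by
    refine isFixedPt_of_tendsto_iterate (f := f^[2]) (x := x) ?_ (hf.iterate 2).continuousAt
    simpa only [← Function.iterate_mul] using h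
  refine ⟨p, hp, tendsto_of_tendsto_even_odd ?_ ?_⟩
  · simpa only [iterate_two_mul_of_sq_eq hp, dist_self] using h.dist (tendsto_const_nhds (x := p))
  · simpa only [Function.comp_def, Function.iterate_succ_apply', iterate_two_mul_of_sq_eq hp,
      dist_self] using ((hf.tendsto p).comp h).dist (tendsto_const_nhds (x := f p))

theorem eq_of_exists_dist_iterate_lt {X : Type*} [MetricSpace X] {f : X → X} {u v : X}
    (hu : f (f u) = u) (hv : f (f v) = v) (h : ∀ ε > 0, ∃ n, dist (f^[n] u) (f^[n] v) < ε) :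
    u = v := by
  by_contra hne
  have hfne : f u ≠ f v := fun heq => hne (by rw [← hu, heq, hv])
  obtain ⟨n, hn⟩ := h (min (dist u v) (dist (f u) (f v)))
    (lt_min (dist_pos.2 hne) (dist_pos.2 hfne))
  obtain ⟨k, rfl | rfl⟩ := Nat.even_or_odd' n
  · rw [iterate_two_mul_of_sq_eq hu, iterate_two_mul_of_sq_eq hv] at hn
    exact (min_le_left _ _).not_gt hn
  · rw [Function.iterate_succ_apply', Function.iterate_succ_apply', iterate_two_mul_of_sq_eq hu,
      iterate_two_mul_of_sq_eq hv] at hn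
    exact (min_le_right _ _).not_gt hn

theorem tendsto_dist_iterate_of_proximal {X : Type*} [MetricSpace X] {f : X → X} {u v : X}
    (hu : IsAsymptPeriodicOneOrTwo f u) (hv : IsAsymptPeriodicOneOrTwo f v)
    (h : ∀ ε > 0, ∃ᶠ n in atTop, dist (f^[n] u) (f^[n] v) < ε) :
    Tendsto (fun n => dist (f^[n] u) (f^[n] v)) atTop (𝓝 0) := by
  obtain ⟨p, hp, hup⟩ := hu
  obtain ⟨q, hq, hvq⟩ := hv
  obtain rfl : p = q := by
    refine eq_of_exists_dist_iterate_lt hp hq fun ε hε => ?_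
    have hε3 : 0 < ε / 3 := by positivity
    obtain ⟨n, huv, hun, hvn⟩ := ((h _ hε3).and_eventually
      ((hup.eventually_lt_const hε3).and (hvq.eventually_lt_const hε3))).exists
    refine ⟨n, ?_⟩
    calc dist (f^[n] p) (f^[n] q)
        ≤ dist (f^[n] p) (f^[n] u) + dist (f^[n] u) (f^[n] v) + dist (f^[n] v) (f^[n] q) :=
          dist_triangle4 ..
      _ < ε / 3 + ε / 3 + ε / 3 := by rw [dist_comm (f^[n] p)]; gcongr
      _ = ε := add_thirds ε
  refine squeeze_zero (fun _ => dist_nonneg)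
    (fun n => dist_triangle_right (f^[n] u) (f^[n] v) (f^[n] p)) ?_
  simpa only [add_zero] using hup.add hvq

theorem exists_not_isAsymptPeriodicOneOrTwo {X : Type*} [MetricSpace X] [CompactSpace X]
    {f : X → X} {w : X × X} (hw : w ∈ liYorkePairs f) : ∃ x, ¬ IsAsymptPeriodicOneOrTwo f x := by
  by_contra! hall
  exact hw.1.ne' (tendsto_dist_iterate_of_proximal (hall w.1) (hall w.2) fun ε hε =>
    frequently_dist_lt_of_liminf_eq_zero hw.2 hε).limsup_eq

end AsymptoticallyPeriodic

section ProximalPairs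

variable {X : Type*} [CompleteLinearOrder X] [DenselyOrdered X] [MetricSpace X] [OrderTopology X]
  {f : X → X}

theorem exists_alternates_sq_lt (hf : Continuous f) (hno : ¬ HasOneSidedHorseshoe f) {c : X}
    (hc : ¬ IsAsymptPeriodicOneOrTwo f c) :
    ∃ z y, f z = z ∧ Alternates f z y ∧ f (f y) < y ∧ f (f (f y)) ≠ f y := by
  rcases tendsto_or_alternates hf hno c with ⟨p, hp⟩ | ⟨z, N, hz, halt⟩
  · exact absurd (isAsymptPeriodicOneOrTwo_of_tendsto_even hf
      (hp.comp (tendsto_id.const_mul_atTop' two_pos))) hc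
  obtain ⟨k, hk⟩ : ∃ k, f^[2 * (k + 1)] (f^[N] c) < f^[2 * k] (f^[N] c) := by
    by_contra! hmono
    exact hc (isAsymptPeriodicOneOrTwo_of_tendsto_even hf
      (tendsto_atTop_iSup (monotone_nat_of_le_succ hmono))).of_iterate
  rw [iterate_two_mul_succ_apply] at hk
  refine ⟨z, f^[2 * k] (f^[N] c), hz, halt.iterate k, hk, fun heq => hc ?_⟩
  have hfy : IsAsymptPeriodicOneOrTwo f (f (f^[2 * k] (f^[N] c))) :=
    ⟨_, heq, by simpa only [dist_self] using tendsto_const_nhds⟩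
  rw [← Function.iterate_succ_apply' f, ← Function.iterate_add_apply] at hfy
  exact hfy.of_iterate

theorem hasOneSidedHorseshoe_of_dense_proximalPairs (hf : Continuous f) {c : X}
    (hc : ¬ IsAsymptPeriodicOneOrTwo f c) (hdense : Dense (proximalPairs f)) :
    HasOneSidedHorseshoe f := by
  by_contra hno
  obtain ⟨z, y, hz, halt, hlt, hne⟩ := exists_alternates_sq_lt hf hno hc
  obtain ⟨p, ⟨hu, hw⟩, hprox⟩ := hdense.inter_open_nonempty _ (isOpen_Ioo.prod isOpen_Ioo)
    ((nonempty_Ioo.2 hlt).prod (nonempty_Ioo.2 (min_lt_max.2 hne)))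
  exact halt.notMem_proximalPairs hf (fun h => hno (.inl h)) hz (Ioo_subset_Ico_self hu)
    (Ioo_subset_Icc_self hw) hprox

theorem hasOneSidedHorseshoe_of_isDenselyChaotic (hf : Continuous f)
    (h : IsDenselyChaotic f) : HasOneSidedHorseshoe f := by
  obtain ⟨w, hw⟩ := h.nonempty
  obtain ⟨x, hx⟩ := exists_not_isAsymptPeriodicOneOrTwo hw
  exact hasOneSidedHorseshoe_of_dense_proximalPairs hf hx (h.mono fun _ hw => hw.2)

end ProximalPairs

section TrappingRegion

/-- A trapping region of `f`: a nonempty closed set that `f` maps into its interior. A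
chain with small enough steps cannot leave it, which limits chain recurrence. -/
def IsTrappingRegion {X : Type*} [TopologicalSpace X] (f : X → X) (C : Set X) : Prop :=
  IsClosed C ∧ C.Nonempty ∧ MapsTo f C (interior C)

theorem IsChainRecurrentPt.mem_closure_image {X : Type*} [PseudoMetricSpace X]
    {f : X → X} {C : Set X} (himage : IsCompact (f '' C)) (hC : MapsTo f C (interior C)) {x : X}
    (hx : IsChainRecurrentPt f x) (hxC : x ∈ C) : x ∈ closure (f '' C) := by
  obtain ⟨δ, hδ, hδC⟩ := himage.exists_thickening_subset_open isOpen_interior hC.image_subset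
  refine Metric.mem_closure_iff.2 fun ε hε => ?_
  obtain ⟨n, u, hn, hu0, hun, hu⟩ := hx (min ε δ) (lt_min hε hδ)
  have hmem : ∀ i ≤ n, u i ∈ C := fun i => by
    induction i with
    | zero => exact fun _ => hu0 ▸ hxC
    | succ i ih =>
      refine fun hi => interior_subset (hδC (Metric.mem_thickening_iff.2
        ⟨_, mem_image_of_mem f (ih (by lia)), ?_⟩))
      rw [dist_comm]
      exact (hu i hi).trans_le (min_le_right _ _)
  obtain ⟨m, rfl⟩ := Nat.exists_eq_add_of_le' hn
  refine ⟨_, mem_image_of_mem f (hmem m (by lia)), ?_⟩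
  rw [← hun, dist_comm]
  exact (hu m (by lia)).trans_le (min_le_left _ _)

theorem IsTrappingRegion.image_eq_univ {X : Type*} [MetricSpace X] [CompactSpace X]
    [PreconnectedSpace X] {f : X → X} (hf : Continuous f)
    (hdense : Dense {x | IsChainRecurrentPt f x}) {C : Set X} (hC : IsTrappingRegion f C) :
    f '' C = univ := by
  obtain ⟨hclosed, hne, hmaps⟩ := hC
  have himage := hclosed.isCompact.image hf
  have hsub : interior C ⊆ f '' C := by
    refine (hdense.open_subset_closure_inter isOpen_interior).trans
      (closure_minimal (fun x hx => ?_) himage.isClosed)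
    rw [← himage.isClosed.closure_eq]
    exact hx.2.mem_closure_image himage hmaps (interior_subset hx.1)
  have heq : f '' C = interior C := hmaps.image_subset.antisymm hsub
  have hclopen : IsClopen (f '' C) := ⟨himage.isClosed, heq ▸ isOpen_interior⟩
  exact (isClopen_iff.1 hclopen).resolve_left (hne.image f).ne_empty

theorem IsTrappingRegion.eq_univ {X : Type*} [TopologicalSpace X] {f : X → X} {C : Set X}
    (hC : IsTrappingRegion f C) (himage : f '' C = univ) : C = univ :=
  univ_subset_iff.1 (himage ▸ hC.2.2.image_subset.trans interior_subset)

theorem IsTrappingRegion.exists_of_comp_self {X : Type*} [TopologicalSpace X] [CompactSpace X]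
    [T2Space X] {f : X → X} (hf : Continuous f) {C : Set X} (hC : IsTrappingRegion (f ∘ f) C) :
    ∃ V, MapsTo f V (interior C) ∧ IsTrappingRegion f (C ∪ V) := by
  obtain ⟨hclosed, hne, hmaps⟩ := hC
  obtain ⟨U, hU, hCU, hUC⟩ := normal_exists_closure_subset (hclosed.isCompact.image hf).isClosed
    (isOpen_interior.preimage hf) (image_subset_iff.2 hmaps)
  refine ⟨closure U, hUC, hclosed.union isClosed_closure, hne.inl, ?_⟩
  rintro t (ht | ht)
  · exact interior_maximal (subset_closure.trans subset_union_right) hU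
      (hCU (mem_image_of_mem f ht))
  · exact interior_mono subset_union_left (hUC ht)

theorem not_isTrappingRegion_comp_self {X : Type*} [TopologicalSpace X] [CompactSpace X]
    [T2Space X] {f : X → X} (hf : Continuous f)
    (htrap : ∀ C, IsTrappingRegion f C → f '' C = univ) {z : X} (hz : f z = z) {C : Set X}
    (hzC : z ∉ C) : ¬ IsTrappingRegion (f ∘ f) C := fun hC => by
  obtain ⟨V, hV, hCV⟩ := hC.exists_of_comp_self hf
  have hzV : z ∈ C ∪ V := hCV.eq_univ (htrap _ hCV) ▸ mem_univ z
  exact hzC (interior_subset (hz ▸ hV (hzV.resolve_left hzC)))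

theorem isTrappingRegion_Iic {X : Type*} [LinearOrder X] [TopologicalSpace X]
    [OrderClosedTopology X] {f : X → X} {b : X} (h : ∀ t ≤ b, f t < b) :
    IsTrappingRegion f (Iic b) :=
  ⟨isClosed_Iic, nonempty_Iic, fun t ht => interior_maximal Iio_subset_Iic_self isOpen_Iio (h t ht)⟩

theorem isTrappingRegion_Icc {X : Type*} [LinearOrder X] [TopologicalSpace X]
    [OrderClosedTopology X] {f : X → X} {a b : X} (hab : a ≤ b)
    (h : MapsTo f (Icc a b) (Ioo a b)) : IsTrappingRegion f (Icc a b) :=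
  ⟨isClosed_Icc, nonempty_Icc.2 hab,
    fun _ ht => interior_maximal Ioo_subset_Icc_self isOpen_Ioo (h ht)⟩

variable {X : Type*} [CompleteLinearOrder X] [DenselyOrdered X] [TopologicalSpace X]
  [OrderTopology X] {f : X → X}

theorem exists_maps_above (hf : Continuous f) {p q x : X}
    (htrap : ∀ C ⊆ Iio q, ¬ IsTrappingRegion f C) (hpq : p ≤ q) (hxp : x < p)
    (hlt : ∀ s ∈ Ico x p, f s < s) : ∃ y < x, f y = p ∧ ∀ s ∈ Ioc y x, f s < p := by
  have hx : f x < p := (hlt x (left_mem_Ico.2 hxp)).trans hxp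
  obtain ⟨w, hw, hmax⟩ :=
    (isClosed_Iic (a := x)).isCompact.exists_isMaxOn nonempty_Iic hf.continuousOn
  have hpw : p ≤ f w := by
    by_contra! hwp
    obtain ⟨b, hb, hbp⟩ := exists_between (max_lt hwp hxp)
    refine htrap (Iic b) (Iic_subset_Iio.2 (hbp.trans_le hpq))
      (isTrappingRegion_Iic fun t ht => ?_)
    rcases le_or_gt t x with htx | hxt
    · exact (hmax htx).trans_lt ((le_max_left _ _).trans_lt hb)
    · exact (hlt t ⟨hxt.le, ht.trans_lt hbp⟩).trans_le ht
  obtain ⟨y, hy, hyp, hlast⟩ := exists_last_eq_of_le continuous_const hf hw hpw hx.le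
  exact ⟨y, hy.2.lt_of_ne fun h => hx.ne (h ▸ hyp.symm), hyp.symm, hlast⟩

theorem exists_maps_below (hf : Continuous f) {p q x y : X}
    (htrap : ∀ C ⊆ Iio q, ¬ IsTrappingRegion f C) (hpq : p ≤ q) (hyx : y < x) (hxp : x < p)
    (hlt : ∀ s ∈ Ico x p, f s < s) (hylt : ∀ s ∈ Ioc y x, f s < p) :
    ∃ e ∈ Icc y p, f e ≤ y := by
  by_contra! hlow
  obtain ⟨e, he, hmin⟩ :=
    isCompact_Icc.exists_isMinOn (nonempty_Icc.2 (hyx.trans hxp).le) hf.continuousOn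
  obtain ⟨a, hya, ha⟩ := exists_between (lt_min (hlow e he) hyx)
  have hax : a < x := ha.trans_le (min_le_right _ _)
  obtain ⟨s, hs, hmax⟩ := isCompact_Icc.exists_isMaxOn (nonempty_Icc.2 hax.le) hf.continuousOn
  obtain ⟨b, hb, hbp⟩ := exists_between (max_lt (hylt s ⟨hya.trans_le hs.1, hs.2⟩) hxp)
  have hab : a ≤ b := (hax.trans ((le_max_right _ _).trans_lt hb)).le
  refine htrap (Icc a b) (fun t ht => ht.2.trans_lt (hbp.trans_le hpq))
    (isTrappingRegion_Icc hab fun t ht => ⟨?_, ?_⟩)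
  · exact ha.trans_le ((min_le_left _ _).trans (hmin ⟨hya.le.trans ht.1, ht.2.trans hbp.le⟩))
  · rcases le_or_gt t x with htx | hxt
    · exact (hmax ⟨ht.1, htx⟩).trans_lt ((le_max_left _ _).trans_lt hb)
    · exact (hlt t ⟨hxt.le, ht.2.trans_lt hbp⟩).trans_le ht.2

theorem exists_fold_of_lt (hf : Continuous f) {q x : X}
    (htrap : ∀ C ⊆ Iio q, ¬ IsTrappingRegion f C) (hq : f q = q) (hxq : x < q) (hx : f x < x) :
    ∃ y e p, y < e ∧ e < p ∧ p ≤ q ∧ f y = p ∧ f p = p ∧ f e ≤ y := by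
  obtain ⟨p, ⟨hxp, hpq⟩, hp, hlt⟩ := exists_first_eq_of_le hf continuous_id hxq.le hx.le hq.ge
  replace hxp : x < p := hxp.lt_of_ne fun h => hx.ne (h ▸ hp)
  obtain ⟨y, hyx, hyp, hylt⟩ := exists_maps_above hf htrap hpq hxp hlt
  obtain ⟨e, he, hey⟩ := exists_maps_below hf htrap hpq hyx hxp hlt hylt
  have hyp' : y < p := hyx.trans hxp
  refine ⟨y, e, p, he.1.lt_of_ne ?_, he.2.lt_of_ne ?_, hpq, hyp, hp, hey⟩
  · rintro rfl
    exact hyp'.not_ge (hyp ▸ hey)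
  · rintro rfl
    exact hyp'.not_ge (hp.symm.le.trans hey)

theorem le_map_of_lt_fixedPt (hf : Continuous f) (htrap : ∀ C, IsTrappingRegion f C → f '' C = univ)
    (hno : ¬ HasOneSidedHorseshoe f) {q x : X} (hq : f q = q) (hxq : x < q) : x ≤ f x := by
  by_contra! hx
  have hbelow : ∀ C ⊆ Iio q, ¬ IsTrappingRegion f C := fun C hCq hC =>
    lt_irrefl q (hCq (hC.eq_univ (htrap C hC) ▸ mem_univ q))
  obtain ⟨y, e, p, hye, hep, -, hy, hp, he⟩ := exists_fold_of_lt hf hbelow hq hxq hx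
  obtain ⟨s, hs, hsy⟩ := intermediate_value_Icc hep.le hf.continuousOn
    ⟨he, (hye.trans hep).le.trans_eq hp.symm⟩
  obtain ⟨c, hc, hcs⟩ := intermediate_value_Icc hs.2 hf.continuousOn
    ⟨hsy.le.trans (hye.le.trans hs.1), hs.2.trans_eq hp.symm⟩
  have hreturn : f^[3] c = p := by
    rw [Function.iterate_succ_apply, Function.iterate_succ_apply, Function.iterate_one, hcs, hsy,
      hy]
  have hsc : s < c := hc.1.lt_of_ne fun h => (hye.trans_le hs.1).ne (hsy ▸ (h ▸ hcs))
  exact hno (hasOneSidedHorseshoe_of_le_odd_return hf (n := 3) (by decide)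
    (hc.2.trans_eq hreturn.symm) (hcs.trans_lt hsc))

theorem exists_jump_over_fixedPt (hf : Continuous f)
    (htrap : ∀ C, IsTrappingRegion f C → f '' C = univ) {z v : X} (hz : f z = z) (hvz : v < z)
    (habove : ∀ t ∈ Icc v z, v < f t) (hright : ∀ t, z < t → f t < t) :
    ∃ w ∈ Icc v z, ∃ y, z < y ∧ y ≤ f w ∧ f y ≤ v := by
  have hmiss : ∀ C, (∀ t ∈ C, v < f t) → ¬ IsTrappingRegion f C := fun C hv hC => by
    obtain ⟨t, ht, htv⟩ := (htrap C hC).symm ▸ mem_univ v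
    exact (hv t ht).ne' htv
  obtain ⟨y₁, hvy₁, hy₁⟩ : ∃ y, v ≤ y ∧ f y ≤ v := by
    by_contra! h
    exact hmiss (Ici v) h (isTrappingRegion_Iic (X := Xᵒᵈ) h)
  have hzy₁ : z ≤ y₁ := le_of_not_gt fun h => (habove y₁ ⟨hvy₁, h.le⟩).not_ge hy₁
  obtain ⟨y, hy, hvy, hfirst⟩ :=
    exists_first_eq_of_le continuous_const hf hzy₁ (hvz.le.trans hz.ge) hy₁
  obtain ⟨w, hw, hmax⟩ := isCompact_Icc.exists_isMaxOn (nonempty_Icc.2 hvz.le) hf.continuousOn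
  have hzy : z < y := hy.1.lt_of_ne fun h => hvz.ne (hvy.trans (h ▸ hz))
  refine ⟨w, hw, y, hzy, ?_, hvy.ge⟩
  by_contra! hwy
  obtain ⟨b, hwb, hby⟩ := exists_between hwy
  have hlow : ∀ t ∈ Icc v b, v < f t := fun t ht => by
    rcases le_or_gt t z with htz | hzt
    exacts [habove t ⟨ht.1, htz⟩, hfirst t ⟨hzt.le, ht.2.trans_lt hby⟩]
  refine hmiss (Icc v b) hlow (isTrappingRegion_Icc ?_ fun t ht => ⟨hlow t ht, ?_⟩)
  · exact ((habove w hw).trans hwb).le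
  · rcases le_or_gt t z with htz | hzt
    exacts [(hmax ⟨ht.1, htz⟩).trans_lt hwb, (hright t hzt).trans_le ht.2]

theorem fixedPt_lt_map (hf : Continuous f) (htrap : ∀ C, IsTrappingRegion f C → f '' C = univ)
    (hno : ¬ HasLeftHorseshoe f) {z v : X} (hz : f z = z) (hright : ∀ t, z < t → f t < t)
    (hleft : ∀ t < z, t ≤ f t) (hvz : v < z) (hv : v < f v) : z < f v := by
  by_contra! hvz'
  have habove : ∀ t ∈ Icc v z, v < f t := fun t ht => by
    rcases ht.1.eq_or_lt with rfl | hvt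
    · exact hv
    rcases ht.2.eq_or_lt with rfl | htz
    exacts [hvt.trans_eq hz.symm, hvt.trans_le (hleft t htz)]
  obtain ⟨w, hw, y, hzy, hyw, hy⟩ := exists_jump_over_fixedPt hf htrap hz hvz habove hright
  have hzw : z < f w := hzy.trans_le hyw
  refine hno (hasLeftHorseshoe_of_jump hf hz (hw.1.lt_of_ne ?_) (hw.2.lt_of_ne ?_) hvz' hzy hyw hy)
  · rintro rfl
    exact hvz'.not_gt hzw
  · rintro rfl
    exact hzw.ne' hz

theorem exists_swapping_fixedPt (hf : Continuous f)
    (htrap : ∀ C, IsTrappingRegion f C → f '' C = univ) (hno : ¬ HasOneSidedHorseshoe f) {a : X}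
    (ha : a < f a) : ∃ z, f z = z ∧ (∀ v < z, z < f v) ∧ ∀ v, z < v → f v < z := by
  have hle : ∀ {q x}, f q = q → x < q → x ≤ f x := le_map_of_lt_fixedPt hf htrap hno
  have hge : ∀ {q x}, f q = q → q < x → f x ≤ x :=
    le_map_of_lt_fixedPt (X := Xᵒᵈ) hf htrap (mt HasOneSidedHorseshoe.of_orderDual hno)
  have hcompact : IsCompact {t | f t = t} := (isClosed_eq hf continuous_id).isCompact
  have hne : {t | f t = t}.Nonempty := by
    obtain ⟨t, -, ht, -⟩ := exists_first_eq_of_le continuous_id hf bot_le bot_le le_top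
    exact ⟨t, ht.symm⟩
  obtain ⟨z, hz, hzmin⟩ := hcompact.exists_isLeast hne
  obtain ⟨z', hz', hzmax⟩ := hcompact.exists_isGreatest hne
  have hleft : ∀ t < z, t < f t := fun t ht =>
    (hle hz ht).lt_of_ne fun h => ht.not_ge (hzmin h.symm)
  have hright : ∀ t, z' < t → f t < t := fun t ht =>
    (hge hz' ht).lt_of_ne fun h => ht.not_ge (hzmax h)
  have haz : a < z := by
    refine lt_of_not_ge fun hza => ha.not_ge ?_
    rcases hza.eq_or_lt with rfl | hza
    exacts [hz.le, hge hz hza]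
  have hzz' : z ≤ z' := hzmin hz'
  have hswap : ∀ v < z, z' < f v := fun v hv => fixedPt_lt_map hf htrap (fun h => hno (.inl h)) hz'
    hright (fun t ht => hle hz' ht) (hv.trans_le hzz') (hleft v hv)
  obtain rfl : z = z' := by
    obtain ⟨s, hs, hsz'⟩ := intermediate_value_Icc' haz.le hf.continuousOn
      ⟨hz.le.trans hzz', (hswap a haz).le⟩
    rcases hs.2.eq_or_lt with rfl | hsz
    exacts [hz.symm.trans hsz', absurd hsz' (hswap s hsz).ne']
  exact ⟨z, hz, hswap, fun v hv => fixedPt_lt_map (X := Xᵒᵈ) hf htrap (fun h => hno (.inr h)) hz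
    hleft (fun t ht => hge hz ht) hv (hright v hv)⟩

theorem sq_eq_of_lt_swapping_fixedPt (hf : Continuous f)
    (htrap : ∀ C, IsTrappingRegion f C → f '' C = univ) (hno : ¬ HasLeftHorseshoe f) {z : X}
    (hz : f z = z) (hleft : ∀ v ≤ z, z ≤ f v) (hright : ∀ v, z ≤ v → f v ≤ z) {x : X}
    (hxz : x < z) : f (f x) = x := by
  have hge : ∀ t < z, t ≤ f (f t) := fun t htz => by
    by_contra! ht
    obtain ⟨y, e, p, hye, hep, hpz, hy, hp, he⟩ := exists_fold_of_lt (hf.comp hf)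
      (fun C hC => not_isTrappingRegion_comp_self hf htrap hz fun hzC => lt_irrefl z (hC hzC))
      ((congrArg f hz).trans hz) htz ht
    exact hno ⟨y, e, p, z, hye, hep, hpz, hleft y ((hye.trans hep).le.trans hpz),
      hleft e (hep.le.trans hpz), hleft p hpz, hy.ge, hp.ge, he⟩
  by_contra hne
  have habove : ∀ t ∈ Icc x z, x < f (f t) := fun t ht => by
    rcases ht.1.eq_or_lt with rfl | hxt
    · exact (hge x hxz).lt_of_ne' hne
    rcases ht.2.eq_or_lt with rfl | htz
    exacts [by rwa [hz, hz], hxt.trans_le (hge t htz)]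
  have hlow : ∀ t ∈ Icc x z, x < f t := fun t ht => hxz.trans_le (hleft t ht.2)
  obtain ⟨w, hw, y, hzy, hyw, hy⟩ := exists_jump_over_fixedPt hf htrap hz hxz hlow
    fun t ht => (hright t ht.le).trans_lt ht
  obtain ⟨s, hs, rfl⟩ := intermediate_value_Icc' hw.2 hf.continuousOn ⟨hz.le.trans hzy.le, hyw⟩
  exact (habove s ⟨hw.1.trans hs.1, hs.2⟩).not_ge hy

theorem sq_eq_of_forall_isTrappingRegion (hf : Continuous f)
    (htrap : ∀ C, IsTrappingRegion f C → f '' C = univ) (hno : ¬ HasOneSidedHorseshoe f) (a : X) :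
    f (f a) = a := by
  by_contra hne
  obtain ⟨z, hz, hl, hr⟩ : ∃ z, f z = z ∧ (∀ v < z, z < f v) ∧ ∀ v, z < v → f v < z := by
    rcases lt_trichotomy a (f a) with ha | ha | ha
    · exact exists_swapping_fixedPt hf htrap hno ha
    · exact absurd (by rw [← ha, ← ha]) hne
    · obtain ⟨z, hz, hr, hl⟩ := exists_swapping_fixedPt (X := Xᵒᵈ) hf htrap
        (mt HasOneSidedHorseshoe.of_orderDual hno) ha
      exact ⟨z, hz, hl, hr⟩
  have hleft : ∀ v ≤ z, z ≤ f v := fun v hv => by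
    rcases hv.eq_or_lt with rfl | hv
    exacts [hz.ge, (hl v hv).le]
  have hright : ∀ v, z ≤ v → f v ≤ z := fun v hv => by
    rcases hv.eq_or_lt with rfl | hv
    exacts [hz.le, (hr v hv).le]
  rcases lt_trichotomy a z with ha | rfl | ha
  · exact hne (sq_eq_of_lt_swapping_fixedPt hf htrap (fun h => hno (.inl h)) hz hleft hright ha)
  · exact hne (by rw [hz, hz])
  · exact hne (sq_eq_of_lt_swapping_fixedPt (X := Xᵒᵈ) hf htrap (fun h => hno (.inr h)) hz hright
      hleft ha)

end TrappingRegion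

theorem hasOneSidedHorseshoe_of_odd_minimalPeriod {X : Type*} [CompleteLinearOrder X]
    [DenselyOrdered X] [TopologicalSpace X] [OrderTopology X] {f : X → X} (hf : Continuous f)
    {c : X} (hodd : Odd (Function.minimalPeriod f c)) (hone : 1 < Function.minimalPeriod f c) :
    HasOneSidedHorseshoe f := by
  have hreturn : f^[Function.minimalPeriod f c] c = c := Function.iterate_minimalPeriod
  have hne : f c ≠ c := fun h => hone.ne' (Function.minimalPeriod_eq_one_iff_isFixedPt.2 h)
  rcases hne.lt_or_gt with hlt | hlt
  · exact hasOneSidedHorseshoe_of_le_odd_return hf hodd hreturn.ge hlt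
  · exact hasOneSidedHorseshoe_of_odd_return_le hf hodd hreturn.le hlt

theorem corollary2_general {X : Type*} [CompleteLinearOrder X] [DenselyOrdered X] [MetricSpace X]
    [OrderTopology X] (f : X → X) (hf : Continuous f) :
    ((∃ (c : X) (n : ℕ), Odd n ∧ 1 < n ∧
        ((f^[n] c ≤ c ∧ c < f c) ∨ (f c < c ∧ c ≤ f^[n] c))) →
      HasAllEvenPeriods f ∧ IsDoublyTurbulent f^[2]) ∧
    ((∃ c : X, Odd (Function.minimalPeriod f c) ∧ 1 < Function.minimalPeriod f c) →
      HasAllEvenPeriods f ∧ IsDoublyTurbulent f^[2]) ∧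
    (Dense {x : X | IsChainRecurrentPt f x} ∧ (∃ a : X, f^[2] a ≠ a) →
      HasAllEvenPeriods f ∧ IsDoublyTurbulent f^[2]) ∧
    ((∃ b z y : X, f z = z ∧ y ≠ z ∧ z ∈ omegaLimitSet f b ∧ y ∈ omegaLimitSet f b) →
      HasAllEvenPeriods f ∧ IsDoublyTurbulent f^[2]) ∧
    ((∃ x : X, ¬ IsAsymptPeriodicOneOrTwo f x) ∧ Dense (proximalPairs f) →
      HasAllEvenPeriods f ∧ IsDoublyTurbulent f^[2]) ∧
    (IsDenselyChaotic f → HasAllEvenPeriods f ∧ IsDoublyTurbulent f^[2]) ∧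
    ((∃ c : X,
        0 < limsup (fun n : ℕ => dist (f^[n] c) (f^[n + 1] c)) atTop ∧
        liminf (fun n : ℕ => dist (f^[n] c) (f^[n + 1] c)) atTop = 0) →
      HasAllEvenPeriods f ∧ IsDoublyTurbulent f^[2]) := by
  have hconcl : HasOneSidedHorseshoe f → HasAllEvenPeriods f ∧ IsDoublyTurbulent f^[2] :=
    HasOneSidedHorseshoe.hasAllEvenPeriods_and_isDoublyTurbulent hf
  refine ⟨?_, ?_, ?_, ?_, ?_, fun h => hconcl (hasOneSidedHorseshoe_of_isDenselyChaotic hf h), ?_⟩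
  · rintro ⟨c, n, hn, -, ⟨hle, hlt⟩ | ⟨hlt, hle⟩⟩
    · exact hconcl (hasOneSidedHorseshoe_of_odd_return_le hf hn hle hlt)
    · exact hconcl (hasOneSidedHorseshoe_of_le_odd_return hf hn hle hlt)
  · rintro ⟨c, hodd, hone⟩
    exact hconcl (hasOneSidedHorseshoe_of_odd_minimalPeriod hf hodd hone)
  · rintro ⟨hdense, a, ha⟩
    refine hconcl (by_contra fun hno => ha ?_)
    exact sq_eq_of_forall_isTrappingRegion hf (fun _ hC => hC.image_eq_univ hf hdense) hno a
  · rintro ⟨b, z, y, hz, hyz, hzb, hyb⟩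
    exact hconcl (hasOneSidedHorseshoe_of_mapClusterPt hf hz hyz
      ((mem_omegaLimit_singleton_iff_mapClusterPt _ _ _ _).1 hzb)
      ((mem_omegaLimit_singleton_iff_mapClusterPt _ _ _ _).1 hyb))
  · rintro ⟨⟨x, hx⟩, hdense⟩
    exact hconcl (hasOneSidedHorseshoe_of_dense_proximalPairs hf hx hdense)
  · rintro ⟨c, hsup, hinf⟩
    exact hconcl (hasOneSidedHorseshoe_of_limsup_liminf_dist hf hsup hinf)

/-- The interval is `I = [α, β]`, a subspace of the real line, so that `dist x y = |x - y|`. -/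
theorem corollary2 (α β : ℝ) (hαβ : α ≤ β) (f : Icc α β → Icc α β) (hf : Continuous f) :
    -- (1)
    ((∃ (c : Icc α β) (n : ℕ), Odd n ∧ 1 < n ∧
        ((f^[n] c ≤ c ∧ c < f c) ∨ (f c < c ∧ c ≤ f^[n] c))) →
      HasAllEvenPeriods f ∧ IsDoublyTurbulent f^[2]) ∧
    -- (1), the particular case
    ((∃ c : Icc α β, Odd (Function.minimalPeriod f c) ∧ 1 < Function.minimalPeriod f c) →
      HasAllEvenPeriods f ∧ IsDoublyTurbulent f^[2]) ∧
    -- (2)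
    (Dense {x : Icc α β | IsChainRecurrentPt f x} ∧ (∃ a : Icc α β, f^[2] a ≠ a) →
      HasAllEvenPeriods f ∧ IsDoublyTurbulent f^[2]) ∧
    -- (3)
    ((∃ b z y : Icc α β, f z = z ∧ y ≠ z ∧ z ∈ omegaLimitSet f b ∧ y ∈ omegaLimitSet f b) →
      HasAllEvenPeriods f ∧ IsDoublyTurbulent f^[2]) ∧
    -- (4)
    ((∃ x : Icc α β, ¬ IsAsymptPeriodicOneOrTwo f x) ∧ Dense (proximalPairs f) →
      HasAllEvenPeriods f ∧ IsDoublyTurbulent f^[2]) ∧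
    -- (4), the particular case
    (IsDenselyChaotic f → HasAllEvenPeriods f ∧ IsDoublyTurbulent f^[2]) ∧
    -- (5)
    ((∃ c : Icc α β,
        0 < limsup (fun n : ℕ => dist (f^[n] c) (f^[n + 1] c)) atTop ∧
        liminf (fun n : ℕ => dist (f^[n] c) (f^[n + 1] c)) atTop = 0) →
      HasAllEvenPeriods f ∧ IsDoublyTurbulent f^[2]) := by
  have : Fact (α ≤ β) := ⟨hαβ⟩
  exact corollary2_general f hf
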